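/- Let $n\ge 2$ and let $U\subset\mathbb R^n$ be a bounded domain (open and connected) with smooth boundary. Let $\psi:\overline U\to\mathbb R$ and $H=H(x,p):\overline U\times\mathbb R^n\to\mathbb R$ be smooth, with $\psi\ge 0$ on $\partial U$. Assume: (1) uniformly in $x\in\overline U$, $$\lim_{|p|\to+\infty}\Big(\tfrac12|H(x,p)|^2+D_xH(x,p)\cdot p\Big)=\lim_{|p|\to+\infty}\frac{H(x,p)}{|p|}=+\infty ;$$ (2) there exists $\Phi\in C^2(U)\cap C^1(\overline U)$ with $\Phi\le\psi$ on $\overline U$, $\Phi=0$ on $\partial U$ and $\Phi+H(x,D\Phi)<0$ in $\overline U$. Let $\gamma:\mathbb R\to[0,+\infty)$ be smooth with $\gamma(s)=0$ for $s\le 0$, $\gamma(s)>0$ and $0<\gamma'(s)\le 1$ for $s>0$, and $\lim_{s\to+\infty}\gamma(s)=+\infty$. Put $\gamma^\varepsilon(s)=\gamma(s/\varepsilon)$ for $\varepsilon>0$. Then there exist constants $\varepsilon_0>0$ and $C>0$, depending only on $U,H,\psi,\gamma$, such that for every $\varepsilon>0$ and every smooth solution $u^\varepsilon\in C^\infty(U)\cap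 C^1(\overline U)$ of the penalized obstacle problem $$u^\varepsilon+H(x,Du^\varepsilon)+\gamma^\varepsilon(u^\varepsilon-\psi)=\varepsilon\Delta u^\varepsilon\ \text{ in } U,\qquad u^\varepsilon=0\ \text{ on }\partial U,$$ one has $$\|u^\varepsilon\|_{L^\infty(U)}\le C,\qquad\text{and, if moreover }\varepsilon<\varepsilon_0,\qquad \|Du^\varepsilon\|_{L^\infty(U)}\le C .$$ -/

import Mathlib

open scoped ContDiff

noncomputable section

namespace ObstacleProblem

/-- `U` has a smooth boundary: near each of its boundary points, `U` is the sublevel set `{r < 0}`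
of a smooth function `r` whose differential does not vanish at that point. -/
def HasSmoothBoundary {n : ℕ} (U : Set (EuclideanSpace ℝ (Fin n))) : Prop :=
  ∀ x₀ ∈ frontier U, ∃ (V : Set (EuclideanSpace ℝ (Fin n))) (r : EuclideanSpace ℝ (Fin n) → ℝ),
    IsOpen V ∧ x₀ ∈ V ∧ ContDiffOn ℝ ∞ r V ∧ fderiv ℝ r x₀ ≠ 0 ∧ U ∩ V = {x ∈ V | r x < 0}

/-- The growth assumption on the Hamiltonian `H = H(x, p)`:
`½ |H(x,p)|² + D_x H(x,p) · p → +∞` and `H(x,p) / |p| → +∞` as `|p| → ∞`,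
uniformly in `x ∈ closure U`. Here `D_x H(x,p) · p` is the derivative of `H(·, p)` at `x` in the
direction `p`, taken within `closure U`. -/
structure IsCoercive {n : ℕ} (U : Set (EuclideanSpace ℝ (Fin n)))
    (H : EuclideanSpace ℝ (Fin n) → EuclideanSpace ℝ (Fin n) → ℝ) : Prop where
  bernstein : ∀ M : ℝ, ∃ R : ℝ, ∀ x ∈ closure U, ∀ p : EuclideanSpace ℝ (Fin n), R ≤ ‖p‖ →
    M ≤ 1 / 2 * |H x p| ^ 2 + fderivWithin ℝ (fun y => H y p) (closure U) x p
  superlinear : ∀ M : ℝ, ∃ R : ℝ, ∀ x ∈ closure U, ∀ p : EuclideanSpace ℝ (Fin n), R ≤ ‖p‖ →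
    M ≤ H x p / ‖p‖

/-- `Φ ∈ C²(U) ∩ C¹(closure U)`, `Φ ≤ ψ` on `closure U`, `Φ = 0` on the boundary, and
`Φ + H(x, DΦ) < 0` on `closure U`. -/
structure IsStrictSubsolution {n : ℕ} (U : Set (EuclideanSpace ℝ (Fin n)))
    (H : EuclideanSpace ℝ (Fin n) → EuclideanSpace ℝ (Fin n) → ℝ)
    (ψ Φ : EuclideanSpace ℝ (Fin n) → ℝ) : Prop where
  contDiffOn_two : ContDiffOn ℝ 2 Φ U
  contDiffOn_one : ContDiffOn ℝ 1 Φ (closure U)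
  le_obstacle : ∀ x ∈ closure U, Φ x ≤ ψ x
  boundary : ∀ x ∈ frontier U, Φ x = 0
  neg : ∀ x ∈ closure U, Φ x + H x (gradientWithin Φ (closure U) x) < 0

/-- The penalty profile `γ : ℝ → [0, ∞)`. -/
structure IsPenalty (γ : ℝ → ℝ) : Prop where
  smooth : ContDiff ℝ ∞ γ
  eq_zero : ∀ s ≤ 0, γ s = 0
  pos : ∀ s > 0, 0 < γ s
  deriv_pos : ∀ s > 0, 0 < deriv γ s
  deriv_le_one : ∀ s > 0, deriv γ s ≤ 1
  tendsto : Filter.Tendsto γ Filter.atTop Filter.atTop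

/-- `γ^ε(s) = γ(s / ε)`. -/
def penalty (γ : ℝ → ℝ) (ε s : ℝ) : ℝ := γ (s / ε)

/-- `u` is a smooth solution of the penalized problem
`u + H(x, Du) + γ^ε(u - ψ) = ε Δu` in `U`, `u = 0` on the boundary of `U`. Smooth means
`u ∈ C^∞(U) ∩ C¹(closure U)`, which includes the case `u ∈ C^∞(closure U)`. -/
structure IsPenalizedSolution {n : ℕ} (U : Set (EuclideanSpace ℝ (Fin n)))
    (H : EuclideanSpace ℝ (Fin n) → EuclideanSpace ℝ (Fin n) → ℝ)
    (ψ : EuclideanSpace ℝ (Fin n) → ℝ) (γ : ℝ → ℝ) (ε : ℝ)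
    (u : EuclideanSpace ℝ (Fin n) → ℝ) : Prop where
  smooth : ContDiffOn ℝ ∞ u U
  contDiffOn_one : ContDiffOn ℝ 1 u (closure U)
  equation : ∀ x ∈ U, u x + H x (gradient u x) + penalty γ ε (u x - ψ x)
    = ε * Laplacian.laplacian u x
  boundary : ∀ x ∈ frontier U, u x = 0

end ObstacleProblem

end

/-!
The maximum principle bounds `u` and the penalty term: `u` is compared with constants at its
extrema (`exists_abs_le`), and the penalty `γ^ε(u - ψ)` is bounded by evaluating the equation at a
maximum of `u - ψ` (`exists_penalty_le`).

The gradient on the boundary is controlled by barriers. A large multiple `-K ρ` of a global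
defining function lies above `u`, because `H` grows superlinearly
(`exists_upper_barrier`). The lower barrier comes from the strict subsolution `Φ`.
Comparison with `Φ` itself is not possible, since `Φ` is only `C¹` up to the boundary and `ΔΦ` may
be unbounded there. Instead a smooth `w < Φ` with `w = 0` and `Dw` close to `DΦ` on the boundary is
constructed (`HasDefiningFunctions.exists_contDiff_lt`); then `max w (Φ - c / 2)` is a strict
subsolution for which only bounded Laplacians matter
(`IsStrictSubsolution.exists_lower_barrier`). Both `ρ` and `w` are obtained by gluing multiples of
local defining functions with a partition of unity (`exists_contDiff_lt_of_local`). The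
construction of `w` uses that `DΦ` is normal on the boundary, which follows by observing that a
function that vanishes on the boundary and decreases in some outward direction is positive in `U`
nearby (`IsDefiningOn.eventually_pos`). Since `w ≤ u ≤ -K ρ` with equality on the boundary, `Du` is
bounded there.

In the interior, Bernstein's method applies at a maximum of `|Du|²`
(`IsPenalizedSolution.bernstein`): differentiating the equation in the direction `p = Du` gives
`½ |H(x, p)|² + D_xH(x, p) · p ≤ (u + γ^ε(u - ψ))²` if `|Du| ≥ |Dψ|`, and the growth
assumption bounds `p`.
-/

noncomputable section

namespace ObstacleProblem

open Set Filter Topology InnerProductSpace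

/-! ### Second-order conditions at extrema and derivatives of the Laplacian -/

section Calculus

variable {E : Type*} [NormedAddCommGroup E] [InnerProductSpace ℝ E]

/-- The necessary second-order condition at a local maximum on the line. -/
theorem second_deriv_nonpos_of_isLocalMax {h h' : ℝ → ℝ} {h'' t₀ : ℝ} (hmax : IsLocalMax h t₀)
    (hd : ∀ᶠ t in 𝓝 t₀, HasDerivAt h (h' t) t) (hdd : HasDerivAt h' h'' t₀) : h'' ≤ 0 := by
  have e1 : deriv h =ᶠ[𝓝 t₀] h' := hd.mono fun t ht => ht.deriv
  have e2 : deriv (deriv h) t₀ = h'' := by rw [e1.deriv_eq, hdd.deriv]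
  by_contra! hpos
  have hmin : IsLocalMin h t₀ :=
    isLocalMin_of_deriv_deriv_pos (by rw [e2]; exact hpos) hmax.deriv_eq_zero
      hd.self_of_nhds.continuousAt
  -- A point that is both a local maximum and a local minimum has a constant neighbourhood.
  have hconst : h =ᶠ[𝓝 t₀] fun _ => h t₀ := by
    filter_upwards [hmax, hmin] with t h1 h2 using le_antisymm h1 h2
  have h0 : deriv h =ᶠ[𝓝 t₀] fun _ => 0 := by
    filter_upwards [hconst.eventuallyEq_nhds] with t ht
    rw [ht.deriv_eq, deriv_const]
  have : deriv (deriv h) t₀ = 0 := by rw [h0.deriv_eq, deriv_const]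
  linarith

theorem hasDerivAt_comp_line {F : Type*} [NormedAddCommGroup F] [NormedSpace ℝ F] {f : E → F}
    {x v : E} {t : ℝ} (hf : DifferentiableAt ℝ f (x + t • v)) :
    HasDerivAt (fun s : ℝ => f (x + s • v)) (fderiv ℝ f (x + t • v) v) t := by
  have h1 : HasDerivAt (fun s : ℝ => x + s • v) v t := by
    simpa using ((hasDerivAt_id t).smul_const v).const_add x
  exact hf.hasFDerivAt.comp_hasDerivAt t h1

theorem tendsto_line (x v : E) : Tendsto (fun s : ℝ => x + s • v) (𝓝 0) (𝓝 x) := by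
  have : Continuous fun s : ℝ => x + s • v := by fun_prop
  simpa using this.tendsto 0

theorem hasDerivAt_fderiv_line {F : Type*} [NormedAddCommGroup F] [NormedSpace ℝ F] {f : E → F}
    {x v : E} (hf : ContDiffAt ℝ 2 f x) :
    HasDerivAt (fun s : ℝ => fderiv ℝ f (x + s • v) v) (fderiv ℝ (fderiv ℝ f) x v v) 0 := by
  have h1 : DifferentiableAt ℝ (fderiv ℝ f) x :=
    (hf.fderiv_right (m := 1) (by norm_num)).differentiableAt (by norm_num)
  have h2 := hasDerivAt_comp_line (f := fderiv ℝ f) (x := x) (v := v) (t := 0) (by simpa using h1)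
  simp only [zero_smul, add_zero] at h2
  exact (ContinuousLinearMap.apply ℝ F v).hasFDerivAt.comp_hasDerivAt 0 h2

theorem eventually_differentiableAt_line {F : Type*} [NormedAddCommGroup F] [NormedSpace ℝ F]
    {f : E → F} {x : E} (v : E) (hf : ContDiffAt ℝ 2 f x) :
    ∀ᶠ t : ℝ in 𝓝 0, DifferentiableAt ℝ f (x + t • v) :=
  (tendsto_line x v).eventually
    ((hf.eventually (by simp)).mono fun y hy => hy.differentiableAt (by norm_num))

theorem fderiv_fderiv_nonpos_of_isLocalMax {f : E → ℝ} {x : E} (hf : ContDiffAt ℝ 2 f x)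
    (hmax : IsLocalMax f x) (v : E) : fderiv ℝ (fderiv ℝ f) x v v ≤ 0 := by
  refine second_deriv_nonpos_of_isLocalMax (h := fun t : ℝ => f (x + t • v)) (t₀ := 0) ?_ ?_
    (hasDerivAt_fderiv_line hf)
  · have := (tendsto_line x v).eventually hmax
    simpa [IsLocalMax, IsMaxFilter] using this
  · exact (eventually_differentiableAt_line v hf).mono fun t ht => hasDerivAt_comp_line ht

/-- At a local maximum of `‖g‖²`, the second-order condition in the direction `v`. -/
theorem norm_sq_fderiv_add_inner_nonpos_of_isLocalMax {g : E → E} {x : E}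
    (hg : ContDiffAt ℝ 2 g x) (hmax : IsLocalMax (fun y => ‖g y‖ ^ 2) x) (v : E) :
    ‖fderiv ℝ g x v‖ ^ 2 + inner ℝ (g x) (fderiv ℝ (fderiv ℝ g) x v v) ≤ 0 := by
  have key : 2 * (‖fderiv ℝ g x v‖ ^ 2 + inner ℝ (g x) (fderiv ℝ (fderiv ℝ g) x v v)) ≤ 0 := by
    refine second_deriv_nonpos_of_isLocalMax (h := fun t : ℝ => ‖g (x + t • v)‖ ^ 2)
      (h' := fun t => 2 * inner ℝ (g (x + t • v)) (fderiv ℝ g (x + t • v) v)) (t₀ := 0) ?_ ?_ ?_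
    · have := (tendsto_line x v).eventually hmax
      simpa [IsLocalMax, IsMaxFilter] using this
    · exact (eventually_differentiableAt_line v hg).mono fun t ht => (hasDerivAt_comp_line ht).norm_sq
    · have h1 := hasDerivAt_comp_line (f := g) (x := x) (v := v) (t := 0)
        (by simpa using hg.differentiableAt (by norm_num))
      have h2 := (h1.inner ℝ (hasDerivAt_fderiv_line hg (v := v))).const_mul 2
      simp only [zero_smul, add_zero, real_inner_self_eq_norm_sq] at h2
      rwa [add_comm] at h2
  linarith

variable [FiniteDimensional ℝ E]

/-- The inverse of the Riesz isomorphism as a continuous linear map over `ℝ`; it sends the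
differential of a function to its gradient. -/
def ofDual (E : Type*) [NormedAddCommGroup E] [InnerProductSpace ℝ E] [FiniteDimensional ℝ E] :
    (E →L[ℝ] ℝ) →L[ℝ] E :=
  LinearMap.toContinuousLinearMap
    { toFun := fun l => (toDual ℝ E).symm l
      map_add' := fun a c => map_add _ a c
      map_smul' := fun a c => by simp }

theorem ofDual_apply (l : E →L[ℝ] ℝ) : ofDual E l = (toDual ℝ E).symm l := rfl

theorem inner_ofDual (l : E →L[ℝ] ℝ) (v : E) : inner ℝ (ofDual E l) v = l v := by
  simp [ofDual_apply]

theorem laplacian_eq_sum_fderiv {F : Type*} [NormedAddCommGroup F] [NormedSpace ℝ F] {ι : Type*}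
    [Fintype ι] (b : OrthonormalBasis ι ℝ E) (f : E → F) (x : E) :
    Laplacian.laplacian f x = ∑ i, fderiv ℝ (fderiv ℝ f) x (b i) (b i) := by
  rw [laplacian_eq_iteratedFDeriv_orthonormalBasis f b]
  simp [iteratedFDeriv_two_apply]

theorem laplacian_nonpos_of_isLocalMax {f : E → ℝ} {x : E} (hf : ContDiffAt ℝ 2 f x)
    (hmax : IsLocalMax f x) : Laplacian.laplacian f x ≤ 0 := by
  rw [laplacian_eq_sum_fderiv (stdOrthonormalBasis ℝ E)]
  exact Finset.sum_nonpos fun i _ => fderiv_fderiv_nonpos_of_isLocalMax hf hmax _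

/-- First- and second-order conditions where `φ` touches `u` from above, up to a constant. -/
theorem gradient_eq_and_laplacian_le_of_isLocalMax {u φ : E → ℝ} {x : E}
    (hu : ContDiffAt ℝ 2 u x) (hφ : ContDiffAt ℝ 2 φ x)
    (hmax : IsLocalMax (fun y => u y - φ y) x) :
    gradient u x = gradient φ x ∧ Laplacian.laplacian u x ≤ Laplacian.laplacian φ x := by
  constructor
  · have h0 := hmax.fderiv_eq_zero
    rw [fderiv_fun_sub (hu.differentiableAt (by norm_num)) (hφ.differentiableAt (by norm_num)),
      sub_eq_zero] at h0
    simp [gradient, h0]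
  · have h1 := laplacian_nonpos_of_isLocalMax (hu.sub hφ) hmax
    have h2 := hu.laplacian_sub hφ
    have h3 : (fun y => u y - φ y) = u - φ := rfl
    have : Laplacian.laplacian (u - φ) x ≤ 0 := h1
    linarith

theorem gradient_eq_and_laplacian_ge_of_isLocalMin {u φ : E → ℝ} {x : E}
    (hu : ContDiffAt ℝ 2 u x) (hφ : ContDiffAt ℝ 2 φ x)
    (hmin : IsLocalMin (fun y => u y - φ y) x) :
    gradient u x = gradient φ x ∧ Laplacian.laplacian φ x ≤ Laplacian.laplacian u x := by
  have hmax : IsLocalMax (fun y => φ y - u y) x := by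
    filter_upwards [hmin] with y hy
    linarith
  have h := gradient_eq_and_laplacian_le_of_isLocalMax hφ hu hmax
  exact ⟨h.1.symm, h.2⟩

/-- The Laplacian commutes with directional derivatives: the derivative of `Δu` in the direction
`p` is `⟨p, Δ(∇u)⟩`. -/
theorem fderiv_laplacian_apply {ι : Type*} [Fintype ι] (b : OrthonormalBasis ι ℝ E) {u : E → ℝ}
    {x : E} (hu : ContDiffAt ℝ 3 u x) (p : E) :
    DifferentiableAt ℝ (Laplacian.laplacian u) x ∧ fderiv ℝ (Laplacian.laplacian u) x p =
      ∑ i, inner ℝ p (fderiv ℝ (fderiv ℝ (gradient u)) x (b i) (b i)) := by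
  have hD1 : ContDiffAt ℝ 2 (fderiv ℝ u) x := hu.fderiv_right (by norm_num)
  have hD2 : ContDiffAt ℝ 1 (fderiv ℝ (fderiv ℝ u)) x := hD1.fderiv_right (by norm_num)
  have hD2d : DifferentiableAt ℝ (fderiv ℝ (fderiv ℝ u)) x := hD2.differentiableAt (by norm_num)
  set T := fderiv ℝ (fderiv ℝ (fderiv ℝ u)) x with hT
  have hentry : ∀ a c : E, HasFDerivAt (fun y => fderiv ℝ (fderiv ℝ u) y a c)
      ((ContinuousLinearMap.apply ℝ ℝ c ∘L (ContinuousLinearMap.apply ℝ (E →L[ℝ] ℝ) a)) ∘L T) x :=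
    fun a c => HasFDerivAt.comp (g := ContinuousLinearMap.apply ℝ ℝ c ∘L
      (ContinuousLinearMap.apply ℝ (E →L[ℝ] ℝ) a)) x (ContinuousLinearMap.hasFDerivAt _)
      hD2d.hasFDerivAt
  have hlap : Laplacian.laplacian u = fun y => ∑ i, fderiv ℝ (fderiv ℝ u) y (b i) (b i) :=
    funext fun y => laplacian_eq_sum_fderiv b u y
  have hsum := HasFDerivAt.fun_sum (u := Finset.univ) fun i _ => hentry (b i) (b i)
  -- The gradient is the image of the differential under a fixed linear isometry.
  have hgrad : ∀ a : E, inner ℝ p (fderiv ℝ (fderiv ℝ (gradient u)) x a a) = T a a p := by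
    intro a
    have hg1 : ∀ᶠ y in 𝓝 x, fderiv ℝ (gradient u) y = ofDual E ∘L fderiv ℝ (fderiv ℝ u) y := by
      filter_upwards [hD1.eventually (by simp)] with y hy
      exact ((ofDual E).hasFDerivAt.comp y (hy.differentiableAt (by norm_num)).hasFDerivAt).fderiv
    rw [EventuallyEq.fderiv_eq hg1]
    have h3 : HasFDerivAt (fun y => ofDual E ∘L fderiv ℝ (fderiv ℝ u) y)
        ((ContinuousLinearMap.compL ℝ E (E →L[ℝ] ℝ) E (ofDual E)) ∘L T) x :=
      HasFDerivAt.comp (g := ContinuousLinearMap.compL ℝ E (E →L[ℝ] ℝ) E (ofDual E)) x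
        (ContinuousLinearMap.hasFDerivAt _) hD2d.hasFDerivAt
    rw [h3.fderiv, real_inner_comm]
    exact inner_ofDual (T a a) p
  have hsymm1 : ∀ a c : E, T a c = T c a := fun a c =>
    (hD1.isSymmSndFDerivAt (by simp)) a c
  have hsymm2 : ∀ v a c : E, T v a c = T v c a := by
    intro v a c
    have hev : (fun y => fderiv ℝ (fderiv ℝ u) y a c) =ᶠ[𝓝 x]
        fun y => fderiv ℝ (fderiv ℝ u) y c a := by
      filter_upwards [hu.eventually (by simp)] with y hy
      exact ((hy.of_le (by norm_num : (2 : WithTop ℕ∞) ≤ 3)).isSymmSndFDerivAt (by simp)) a c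
    have := hev.fderiv_eq (𝕜 := ℝ)
    rw [(hentry a c).fderiv, (hentry c a).fderiv] at this
    simpa using DFunLike.congr_fun this v
  refine ⟨hlap ▸ hsum.differentiableAt, ?_⟩
  rw [hlap, hsum.fderiv]
  simp only [hgrad, FunLike.coe_sum, Finset.sum_apply]
  refine Finset.sum_congr rfl fun i _ => ?_
  simp only [ContinuousLinearMap.comp_apply, ContinuousLinearMap.apply_apply]
  rw [hsymm1 p (b i), hsymm2]

end Calculus

/-! ### Domains described locally by defining functions -/

section Boundary

variable {E : Type*} [NormedAddCommGroup E] [NormedSpace ℝ E] {U V : Set E} {r : E → ℝ} {z v : E}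

/-- `r` is a smooth function on the open set `V` that describes `U ∩ V` as its sublevel set
`{r < 0}`. No condition is put on the differential of `r`. -/
structure IsDefiningOn (U V : Set E) (r : E → ℝ) : Prop where
  isOpen : IsOpen V
  contDiffOn : ContDiffOn ℝ ∞ r V
  inter_eq : U ∩ V = {x ∈ V | r x < 0}

theorem IsDefiningOn.mem_iff (h : IsDefiningOn U V r) (hz : z ∈ V) : z ∈ U ↔ r z < 0 := by
  have := Set.ext_iff.1 h.inter_eq z
  simpa [hz] using this

theorem IsDefiningOn.contDiffAt (h : IsDefiningOn U V r) (hz : z ∈ V) : ContDiffAt ℝ ∞ r z :=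
  h.contDiffOn.contDiffAt (h.isOpen.mem_nhds hz)

theorem IsDefiningOn.differentiableAt (h : IsDefiningOn U V r) (hz : z ∈ V) :
    DifferentiableAt ℝ r z :=
  (h.contDiffAt hz).differentiableAt (by simp)

theorem IsDefiningOn.continuousAt_fderiv (h : IsDefiningOn U V r) (hz : z ∈ V) :
    ContinuousAt (fderiv ℝ r) z :=
  ((h.contDiffAt hz).fderiv_right (m := ∞) (by simp)).continuousAt

theorem IsDefiningOn.eq_zero (h : IsDefiningOn U V r) (hU : IsOpen U) (hz : z ∈ V)
    (hzf : z ∈ frontier U) : r z = 0 := by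
  rw [hU.frontier_eq] at hzf
  have h1 : 0 ≤ r z := by
    by_contra! hneg
    exact hzf.2 ((h.mem_iff hz).2 hneg)
  refine le_antisymm ?_ h1
  by_contra! hpos
  have hev : ∀ᶠ y in 𝓝 z, 0 < r y ∧ y ∈ V :=
    ((h.differentiableAt hz).continuousAt.eventually_const_lt hpos).and (h.isOpen.mem_nhds hz)
  obtain ⟨y, hy, hyU⟩ := (mem_closure_iff_frequently.1 hzf.1).and_eventually hev |>.exists
  exact absurd ((h.mem_iff hyU.2).1 hy) (not_lt.2 hyU.1.le)

theorem tendsto_line_nhdsGT (x v : E) : Tendsto (fun s : ℝ => x + s • v) (𝓝[>] 0) (𝓝 x) := by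
  have : Continuous fun s : ℝ => x + s • v := by fun_prop
  simpa using (this.tendsto 0).mono_left nhdsWithin_le_nhds

theorem eventually_line_neg {f : E → ℝ} (hf : DifferentiableAt ℝ f z) (h0 : f z = 0)
    (hv : fderiv ℝ f z v < 0) : ∀ᶠ t : ℝ in 𝓝[>] 0, f (z + t • v) < 0 := by
  have h1 : HasDerivAt (fun s : ℝ => z + s • v) v 0 := by
    simpa using ((hasDerivAt_id (0 : ℝ)).smul_const v).const_add z
  have hd : HasDerivAt (fun s : ℝ => f (z + s • v)) (fderiv ℝ f z v) 0 :=
    HasFDerivAt.comp_hasDerivAt (f := fun s : ℝ => z + s • v) 0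
      (by simpa using hf.hasFDerivAt) h1
  have hslope := (hasDerivAt_iff_tendsto_slope.1 hd).mono_left (nhdsGT_le_nhdsNE (0 : ℝ))
  filter_upwards [hslope.eventually_lt_const hv, self_mem_nhdsWithin] with t ht ht0
  have ht0' : (0 : ℝ) < t := ht0
  simp only [slope_def_field, zero_smul, add_zero, h0, sub_zero] at ht
  by_contra! hc
  exact absurd (div_nonneg hc ht0'.le) (not_le.2 ht)

theorem eventually_line_pos {f : E → ℝ} (hf : DifferentiableAt ℝ f z) (h0 : f z = 0)
    (hv : 0 < fderiv ℝ f z v) : ∀ᶠ t : ℝ in 𝓝[>] 0, 0 < f (z + t • v) := by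
  have := eventually_line_neg (f := fun y => -f y) (v := v) hf.neg (by simp [h0])
    (by rw [fderiv_fun_neg]; simpa using hv)
  simpa using this

theorem IsDefiningOn.eventually_line_mem (h : IsDefiningOn U V r) (hU : IsOpen U) (hz : z ∈ V)
    (hzf : z ∈ frontier U) (hv : fderiv ℝ r z v < 0) : ∀ᶠ t : ℝ in 𝓝[>] 0, z + t • v ∈ U := by
  filter_upwards [eventually_line_neg (h.differentiableAt hz) (h.eq_zero hU hz hzf) hv,
    (tendsto_line_nhdsGT z v).eventually (h.isOpen.mem_nhds hz)] with t h1 h2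
  exact (h.mem_iff h2).2 h1

/-- The open cone of directions that point from `z` into `U`. -/
def inwardCone (U : Set E) (z : E) : Set E := interior (posTangentConeAt (closure U) z)

theorem IsDefiningOn.mem_inwardCone (h : IsDefiningOn U V r) (hU : IsOpen U) (hz : z ∈ V)
    (hzf : z ∈ frontier U) (hv : fderiv ℝ r z v < 0) : v ∈ inwardCone U z := by
  have hopen : IsOpen {v | fderiv ℝ r z v < 0} :=
    isOpen_lt (fderiv ℝ r z).continuous continuous_const
  refine mem_interior.2 ⟨_, fun v' hv' => ?_, hopen, hv⟩
  exact mem_posTangentConeAt_of_frequently_mem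
    ((h.eventually_line_mem hU hz hzf hv').mono fun t ht => subset_closure ht).frequently

theorem exists_fderiv_pos_of_ne_zero {l : E →L[ℝ] ℝ} (hl : l ≠ 0) : ∃ v, 0 < l v := by
  obtain ⟨v, hv⟩ : ∃ v, l v ≠ 0 := by
    by_contra! hc
    exact hl (ContinuousLinearMap.ext hc)
  rcases lt_or_gt_of_ne hv with h | h
  · exact ⟨-v, by simpa using h⟩
  · exact ⟨v, h⟩

theorem IsDefiningOn.inwardCone_nonempty (h : IsDefiningOn U V r) (hU : IsOpen U) (hz : z ∈ V)
    (hzf : z ∈ frontier U) (hr : fderiv ℝ r z ≠ 0) : (inwardCone U z).Nonempty := by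
  obtain ⟨v, hv⟩ := exists_fderiv_pos_of_ne_zero hr
  exact ⟨-v, h.mem_inwardCone hU hz hzf (by simpa using hv)⟩

/-- A nonzero linear functional that is nonpositive on the tangent cone is negative on the
directions that point inward. -/
theorem neg_of_mem_inwardCone {l : E →L[ℝ] ℝ} (hl : l ≠ 0)
    (hle : ∀ v ∈ posTangentConeAt (closure U) z, l v ≤ 0) (hv : v ∈ inwardCone U z) : l v < 0 := by
  obtain ⟨a, ha⟩ := exists_fderiv_pos_of_ne_zero hl
  have hev : ∀ᶠ t : ℝ in 𝓝[>] 0, v + t • a ∈ posTangentConeAt (closure U) z :=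
    (tendsto_line_nhdsGT v a).eventually (mem_interior_iff_mem_nhds.1 hv)
  obtain ⟨t, ht, ht0⟩ := (hev.and self_mem_nhdsWithin).exists
  have h1 := hle _ ht
  have h2 : 0 < t * l a := mul_pos ht0 ha
  simp only [map_add, map_smul, smul_eq_mul] at h1
  linarith

theorem IsDefiningOn.fderiv_neg_of_mem_inwardCone (h : IsDefiningOn U V r) (hU : IsOpen U)
    (hz : z ∈ V) (hzf : z ∈ frontier U) (hr : fderiv ℝ r z ≠ 0) (hv : v ∈ inwardCone U z) :
    fderiv ℝ r z v < 0 := by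
  refine neg_of_mem_inwardCone hr (fun a ha => ?_) hv
  have hmax : IsLocalMaxOn r (closure U) z := by
    filter_upwards [nhdsWithin_le_nhds (h.isOpen.mem_nhds hz), self_mem_nhdsWithin] with y hyV hy
    rw [h.eq_zero hU hz hzf]
    rcases em (y ∈ U) with hyU | hyU
    · exact ((h.mem_iff hyV).1 hyU).le
    · exact (h.eq_zero hU hyV (by rw [hU.frontier_eq]; exact ⟨hy, hyU⟩)).le
  exact hmax.hasFDerivWithinAt_nonpos (h.differentiableAt hz).hasFDerivAt.hasFDerivWithinAt ha

theorem IsDefiningOn.uniqueDiffWithinAt (h : IsDefiningOn U V r) (hU : IsOpen U) (hz : z ∈ V)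
    (hzf : z ∈ frontier U) (hr : fderiv ℝ r z ≠ 0) : UniqueDiffWithinAt ℝ (closure U) z := by
  have hsub : {v | fderiv ℝ r z v < 0} ⊆ tangentConeAt ℝ (closure U) z := by
    intro v hv
    exact mem_tangentConeAt_of_add_smul_mem (l := 𝓝[>] (0 : ℝ)) (c := fun t => t)
      (tendsto_id'.2 (nhdsGT_le_nhdsNE (0 : ℝ)))
      ((h.eventually_line_mem hU hz hzf hv).mono fun t ht => subset_closure ht)
  have hopen : IsOpen {v | fderiv ℝ r z v < 0} :=
    isOpen_lt (fderiv ℝ r z).continuous continuous_const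
  obtain ⟨v, hv⟩ := exists_fderiv_pos_of_ne_zero hr
  have htop : Submodule.span ℝ (tangentConeAt ℝ (closure U) z) = ⊤ := by
    refine Submodule.eq_top_of_nonempty_interior' _ ⟨-v, ?_⟩
    exact mem_interior.2 ⟨_, hsub.trans Submodule.subset_span, hopen, by simpa using hv⟩
  refine ⟨?_, subset_closure (frontier_subset_closure hzf)⟩
  rw [htop]
  simp

/-- A function that vanishes on the boundary and decreases, up to the boundary, in an outward
direction `v` is positive in `U` near the boundary point `z`: follow the ray in the direction `v`
until it leaves `U`. -/
theorem IsDefiningOn.eventually_pos (h : IsDefiningOn U V r) (hU : IsOpen U) (hz : z ∈ V)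
    (hzf : z ∈ frontier U) {W : Set E} (hW : W ∈ 𝓝 z) {f : E → ℝ} {f' : E → E →L[ℝ] ℝ}
    (hf : ∀ y ∈ closure U ∩ W, HasFDerivWithinAt f (f' y) (closure U) y)
    (hf' : ContinuousWithinAt f' (closure U) z) (hf0 : ∀ y ∈ frontier U ∩ W, f y = 0)
    (hrv : 0 < fderiv ℝ r z v) (hfv : f' z v < 0) : ∀ᶠ x in 𝓝 z, x ∈ U → 0 < f x := by
  have hneg : ∀ᶠ y in 𝓝 z, y ∈ closure U → f' y v < 0 := by
    have h1 : ContinuousWithinAt (fun y => f' y v) (closure U) z :=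
      ((ContinuousLinearMap.apply ℝ ℝ v).continuous.continuousAt).comp_continuousWithinAt hf'
    exact eventually_nhdsWithin_iff.1 (h1.eventually_lt_const hfv)
  obtain ⟨δ, hδ, hball⟩ := Metric.eventually_nhds_iff_ball.1 (hneg.and hW)
  -- A step `T` for which the end point of the segment from `z` lies in the ball and outside `U`.
  obtain ⟨T, ⟨⟨hT1, hT2⟩, hT3⟩, hT0⟩ :=
    (((eventually_line_pos (h.differentiableAt hz) (h.eq_zero hU hz hzf) hrv).and
      ((tendsto_line_nhdsGT z v).eventually (h.isOpen.mem_nhds hz))).and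
      ((tendsto_line_nhdsGT z v).eventually (Metric.ball_mem_nhds z hδ))).and
      self_mem_nhdsWithin |>.exists
  have hT0' : (0 : ℝ) < T := hT0
  have hcont : Continuous fun x : E => x + T • v := by fun_prop
  have hex : ∀ᶠ x in 𝓝 z, x + T • v ∉ U := by
    have h1 : ∀ᶠ y in 𝓝 (z + T • v), 0 < r y ∧ y ∈ V :=
      ((h.differentiableAt hT2).continuousAt.eventually_const_lt hT1).and
        (h.isOpen.mem_nhds hT2)
    filter_upwards [(hcont.tendsto z).eventually h1] with x hx hxU
    exact absurd ((h.mem_iff hx.2).1 hxU) (not_lt.2 hx.1.le)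
  have hin : ∀ᶠ x in 𝓝 z, x + T • v ∈ Metric.ball z δ :=
    (hcont.tendsto z).eventually (Metric.isOpen_ball.mem_nhds hT3)
  filter_upwards [hex, hin, Metric.ball_mem_nhds z hδ] with x hxU hxT hx0 hx
  have hseg : ∀ t ∈ Icc (0 : ℝ) T, x + t • v ∈ Metric.ball z δ := by
    intro t ht
    have := (convex_ball z δ).add_smul_mem (x := x) (y := T • v) hx0 hxT
      (t := t / T) ⟨div_nonneg ht.1 hT0'.le, (div_le_one hT0').2 ht.2⟩
    rwa [smul_smul, div_mul_cancel₀ _ hT0'.ne'] at this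
  have hline : Continuous fun t : ℝ => x + t • v := by fun_prop
  -- The exit time `τ` of the ray.
  obtain ⟨τ, hτ⟩ : ∃ τ, IsLeast (Icc (0 : ℝ) T ∩ (fun t : ℝ => x + t • v) ⁻¹' Uᶜ) τ :=
    (isCompact_Icc.inter_right (hU.isClosed_compl.preimage hline)).exists_isLeast
      ⟨T, ⟨hT0'.le, le_rfl⟩, hxU⟩
  have hτ0 : 0 < τ := by
    refine lt_of_le_of_ne hτ.1.1.1 ?_
    rintro rfl
    exact hτ.1.2 (by simpa using hx)
  have hlt : ∀ t, 0 ≤ t → t < τ → x + t • v ∈ U := by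
    intro t ht0 htτ
    by_contra hc
    exact absurd (hτ.2 ⟨⟨ht0, htτ.le.trans hτ.1.1.2⟩, hc⟩) (not_le.2 htτ)
  have hle : ∀ t ∈ Icc 0 τ, x + t • v ∈ closure U := by
    have h1 : Icc 0 τ = closure (Ico 0 τ) := (closure_Ico hτ0.ne).symm
    have h2 : MapsTo (fun t : ℝ => x + t • v) (closure (Ico 0 τ)) (closure U) :=
      MapsTo.closure (fun t ht => hlt t ht.1 ht.2) hline
    rw [h1]
    exact h2
  have hWt : ∀ t ∈ Icc 0 τ, x + t • v ∈ W ∧ (x + t • v ∈ closure U → f' (x + t • v) v < 0) := by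
    intro t ht
    have := hball _ (hseg t ⟨ht.1, ht.2.trans hτ.1.1.2⟩)
    exact ⟨this.2, this.1⟩
  have hend : f (x + τ • v) = 0 := by
    refine hf0 _ ⟨?_, (hWt τ ⟨hτ0.le, le_rfl⟩).1⟩
    rw [hU.frontier_eq]
    exact ⟨hle τ ⟨hτ0.le, le_rfl⟩, hτ.1.2⟩
  have hanti : StrictAntiOn (fun t : ℝ => f (x + t • v)) (Icc 0 τ) := by
    refine strictAntiOn_of_deriv_neg (convex_Icc 0 τ) ?_ ?_
    · refine ContinuousOn.comp (t := closure U ∩ W) (g := f) (fun y hy => ?_) hline.continuousOn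
        fun t ht => ⟨hle t ht, (hWt t ht).1⟩
      exact (hf y hy).continuousWithinAt.mono inter_subset_left
    · intro t ht
      rw [interior_Icc] at ht
      have htI : t ∈ Icc 0 τ := Ioo_subset_Icc_self ht
      have htU := hlt t ht.1.le ht.2
      have hd : HasFDerivAt f (f' (x + t • v)) (x + t • v) :=
        (hf _ ⟨hle t htI, (hWt t htI).1⟩).hasFDerivAt
          (mem_of_superset (hU.mem_nhds htU) subset_closure)
      have h1 : HasDerivAt (fun s : ℝ => x + s • v) v t := by
        simpa using ((hasDerivAt_id t).smul_const v).const_add x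
      have hd' : HasDerivAt (fun s : ℝ => f (x + s • v)) (f' (x + t • v) v) t :=
        hd.comp_hasDerivAt t h1
      rw [hd'.deriv]
      exact (hWt t htI).2 (hle t htI)
  have := hanti (left_mem_Icc.2 hτ0.le) (right_mem_Icc.2 hτ0.le) hτ0
  simpa [hend] using this

end Boundary

/-! ### Gluing local functions near a smooth boundary -/

section Gluing

variable {E : Type*} [NormedAddCommGroup E] [NormedSpace ℝ E] {U V : Set E} {r : E → ℝ} {z v : E}

/-- Each boundary point of `U` has a neighbourhood on which `U` is a sublevel set `{r < 0}` with
`Dr ≠ 0` at that point. -/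
def HasDefiningFunctions (U : Set E) : Prop :=
  ∀ z ∈ frontier U, ∃ (V : Set E) (r : E → ℝ), IsDefiningOn U V r ∧ z ∈ V ∧ fderiv ℝ r z ≠ 0

theorem HasDefiningFunctions.uniqueDiffOn (h : HasDefiningFunctions U) (hU : IsOpen U) :
    UniqueDiffOn ℝ (closure U) := by
  intro z hz
  rcases em (z ∈ U) with hzU | hzU
  · exact (hU.uniqueDiffWithinAt hzU).mono subset_closure
  · have hzf : z ∈ frontier U := by rw [hU.frontier_eq]; exact ⟨hz, hzU⟩
    obtain ⟨V, r, hr, hzV, hr0⟩ := h z hzf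
    exact hr.uniqueDiffWithinAt hU hzV hzf hr0

/-- The tangential derivative of a `C¹` function that vanishes on the boundary is zero: otherwise
its differential would be negative in one outward direction and positive in another, and the
function would have both signs in `U` near `z`. -/
theorem IsDefiningOn.exists_fderivWithin_eq_smul (h : IsDefiningOn U V r) (hU : IsOpen U)
    (hz : z ∈ V) (hzf : z ∈ frontier U) (hr : fderiv ℝ r z ≠ 0) (hu : UniqueDiffOn ℝ (closure U))
    {f : E → ℝ} (hf : ContDiffOn ℝ 1 f (closure U)) (hf0 : ∀ y ∈ frontier U, f y = 0) :
    ∃ c : ℝ, fderivWithin ℝ f (closure U) z = c • fderiv ℝ r z := by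
  set l := fderiv ℝ r z with hl
  set g := fderivWithin ℝ f (closure U) with hg
  have hzc : z ∈ closure U := frontier_subset_closure hzf
  obtain ⟨a, ha⟩ := exists_fderiv_pos_of_ne_zero hr
  have hderiv : ∀ y ∈ closure U ∩ univ, HasFDerivWithinAt f (g y) (closure U) y := fun y hy =>
    (hf.differentiableOn (by norm_num) y hy.1).hasFDerivWithinAt
  have hcont : ContinuousWithinAt g (closure U) z :=
    hf.continuousOn_fderivWithin hu le_rfl z hzc
  have hfreq : ∃ᶠ y in 𝓝 z, y ∈ U := mem_closure_iff_frequently.1 hzc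
  refine ⟨g z a / l a, ContinuousLinearMap.ext fun v => ?_⟩
  set v' := v - (l v / l a) • a with hv'
  have hlv' : l v' = 0 := by
    simp only [hv', map_sub, map_smul, smul_eq_mul]
    field_simp
    ring
  have hgv' : g z v' = 0 := by
    by_contra hne
    have hk : ∀ c : ℝ, g z (a + ((c - g z a) / g z v') • v') = c := by
      intro c
      simp only [map_add, map_smul, smul_eq_mul]
      field_simp
      ring
    have hlk : ∀ c : ℝ, l (a + ((c - g z a) / g z v') • v') = l a := by
      intro c
      simp [hlv']
    have h1 := h.eventually_pos hU hz hzf univ_mem hderiv hcont (fun y hy => hf0 y hy.1)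
      (v := a + ((-1 - g z a) / g z v') • v') (by rw [← hl, hlk]; exact ha)
      (by rw [hk]; norm_num)
    have h2 := h.eventually_pos hU hz hzf univ_mem (f := fun y => -f y) (f' := fun y => -g y)
      (fun y hy => (hderiv y hy).fun_neg) hcont.neg (fun y hy => by simp [hf0 y hy.1])
      (v := a + ((1 - g z a) / g z v') • v') (by rw [← hl, hlk]; exact ha)
      (by simp only [neg_apply]; rw [hk]; norm_num)
    obtain ⟨y, hyU, hy1, hy2⟩ := (hfreq.and_eventually (h1.and h2)).exists
    have := hy1 hyU
    have := hy2 hyU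
    linarith
  have : g z v = g z v' + (l v / l a) * g z a := by
    simp [hv']
  rw [this, hgv']
  simp only [smul_apply, smul_eq_mul]
  ring

/-- If a functional satisfies a norm bound in the inward directions, it satisfies it in all
directions. -/
theorem IsDefiningOn.norm_le_of_inwardCone (h : IsDefiningOn U V r) (hU : IsOpen U)
    (hz : z ∈ V) (hzf : z ∈ frontier U) (hr : fderiv ℝ r z ≠ 0) {l : E →L[ℝ] ℝ} {L : ℝ}
    (hL : 0 ≤ L) (hl : ∀ v ∈ inwardCone U z, |l v| ≤ L * ‖v‖) : ‖l‖ ≤ L := by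
  obtain ⟨a, ha⟩ := exists_fderiv_pos_of_ne_zero hr
  have key : ∀ v, fderiv ℝ r z v ≤ 0 → |l v| ≤ L * ‖v‖ := by
    intro v hv
    have hev : ∀ᶠ t : ℝ in 𝓝[>] 0, |l (v + t • -a)| ≤ L * ‖v + t • -a‖ := by
      filter_upwards [self_mem_nhdsWithin] with t ht
      refine hl _ (h.mem_inwardCone hU hz hzf ?_)
      have : 0 < t * fderiv ℝ r z a := mul_pos ht ha
      simp only [map_add, map_smul, map_neg, smul_eq_mul]
      linarith
    have hc1 : Continuous fun x => |l x| := by fun_prop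
    have hc2 : Continuous fun x : E => L * ‖x‖ := by fun_prop
    exact le_of_tendsto_of_tendsto ((hc1.tendsto v).comp (tendsto_line_nhdsGT v (-a)))
      ((hc2.tendsto v).comp (tendsto_line_nhdsGT v (-a))) hev
  refine l.opNorm_le_bound hL fun v => ?_
  rw [Real.norm_eq_abs]
  rcases le_total (fderiv ℝ r z v) 0 with hv | hv
  · exact key v hv
  · simpa using key (-v) (by simpa using hv)

theorem fderiv_le_of_le_of_mem_inwardCone {f g : E → ℝ} {f' g' : E →L[ℝ] ℝ}
    (hf : HasFDerivWithinAt f f' (closure U) z) (hg : HasFDerivWithinAt g g' (closure U) z)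
    (hle : ∀ y ∈ closure U, f y ≤ g y) (heq : f z = g z) (hv : v ∈ inwardCone U z) :
    f' v ≤ g' v := by
  have hmin : IsLocalMinOn (fun y => g y - f y) (closure U) z := by
    filter_upwards [self_mem_nhdsWithin] with y hy
    have := hle y hy
    linarith
  have := hmin.hasFDerivWithinAt_nonneg (hg.fun_sub hf) (interior_subset hv)
  simpa using this

variable [FiniteDimensional ℝ E]

/-- Local smooth functions that vanish on the boundary and lie below `Φ` in `U` can be glued by a
partition of unity. At boundary points the differential of the glued function is a convex
combination of the local differentials, because the local functions vanish there. -/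
theorem exists_contDiff_lt_of_local (hU : IsOpen U) (hUc : IsCompact (closure U)) {Φ : E → ℝ}
    {m : ℝ} (hm : ∀ y ∈ U, m < Φ y) {C : E → Set (E →L[ℝ] ℝ)} (hC : ∀ y, Convex ℝ (C y))
    (hloc : ∀ z ∈ frontier U, ∃ (V : Set E) (φ : E → ℝ), IsOpen V ∧ z ∈ V ∧ ContDiffOn ℝ ∞ φ V ∧
      (∀ y ∈ frontier U ∩ V, φ y = 0) ∧ (∀ y ∈ U ∩ V, φ y < Φ y) ∧
      ∀ y ∈ frontier U ∩ V, fderiv ℝ φ y ∈ C y) :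
    ∃ w : E → ℝ, ContDiff ℝ ∞ w ∧ (∀ y ∈ frontier U, w y = 0) ∧ (∀ y ∈ U, w y < Φ y) ∧
      ∀ y ∈ frontier U, fderiv ℝ w y ∈ C y := by
  have hdisj : ∀ y ∈ frontier U, y ∉ U := fun y hy => by
    rw [hU.frontier_eq] at hy
    exact hy.2
  -- In the interior a constant below `Φ` serves as the local function.
  have hloc' : ∀ z : closure U, ∃ (V : Set E) (φ : E → ℝ), IsOpen V ∧ (z : E) ∈ V ∧
      ContDiffOn ℝ ∞ φ V ∧ (∀ y ∈ frontier U ∩ V, φ y = 0) ∧ (∀ y ∈ U ∩ V, φ y < Φ y) ∧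
      ∀ y ∈ frontier U ∩ V, fderiv ℝ φ y ∈ C y := by
    rintro ⟨z, hz⟩
    rcases em (z ∈ U) with hzU | hzU
    · exact ⟨U, fun _ => m, hU, hzU, contDiffOn_const, fun y hy => absurd hy.2 (hdisj y hy.1),
        fun y hy => hm y hy.1, fun y hy => absurd hy.2 (hdisj y hy.1)⟩
    · exact hloc z (by rw [hU.frontier_eq]; exact ⟨hz, hzU⟩)
  choose V φ hVo hzV hφ hφ0 hφΦ hφC using hloc'
  obtain ⟨t, ht⟩ := hUc.elim_finite_subcover V hVo fun y hy => mem_iUnion.2 ⟨⟨y, hy⟩, hzV _⟩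
  obtain ⟨χ, hχ⟩ := SmoothPartitionOfUnity.exists_isSubordinate (modelWithCornersSelf ℝ E)
    (isClosed_closure (s := U)) (fun i : t => V i) (fun i => hVo i)
    (fun y hy => by simpa using ht hy)
  have hmem : ∀ i y, χ i y ≠ 0 → y ∈ V i := fun i y hy => hχ i (subset_tsupport _ hy)
  have hχd : ∀ i, ContDiff ℝ ∞ (χ i) := fun i => (χ i).contMDiff.contDiff
  have hfin : ∀ y, ∑ᶠ i, χ i y • φ i y = ∑ i, χ i y • φ i y := fun y =>
    finsum_eq_sum_of_fintype _
  have hderiv : ∀ y ∈ frontier U, HasFDerivAt (fun y => ∑ᶠ i, χ i y • φ i y)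
      (∑ᶠ i, χ i y • fderiv ℝ (φ i) y) y := by
    intro y hy
    rw [finsum_eq_sum_of_fintype, funext hfin]
    refine HasFDerivAt.fun_sum fun i _ => ?_
    by_cases hyi : y ∈ tsupport (χ i)
    · have hyV : y ∈ V i := hχ i hyi
      have h1 : HasFDerivAt (χ i) (fderiv ℝ (χ i) y) y :=
        ((hχd i).differentiable (by simp) y).hasFDerivAt
      have h2 : HasFDerivAt (φ i) (fderiv ℝ (φ i) y) y :=
        (((hφ i).contDiffAt ((hVo i).mem_nhds hyV)).differentiableAt (by simp)).hasFDerivAt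
      have h3 := h1.mul h2
      rw [hφ0 i y ⟨hy, hyV⟩, zero_smul, add_zero] at h3
      exact h3
    · have h0 : χ i =ᶠ[𝓝 y] 0 := notMem_tsupport_iff_eventuallyEq.1 hyi
      have h1 : χ i y = 0 := h0.self_of_nhds
      have h2 : (fun y => χ i y • φ i y) =ᶠ[𝓝 y] fun _ => 0 := by
        filter_upwards [h0] with x hx
        simp [hx]
      rw [h1, zero_smul]
      exact (hasFDerivAt_const (0 : ℝ) y).congr_of_eventuallyEq h2
  refine ⟨fun y => ∑ᶠ i, χ i y • φ i y, ?_, fun y hy => ?_, fun y hy => ?_, fun y hy => ?_⟩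
  · refine ContMDiff.contDiff (χ.contMDiff_finsum_smul fun i x hx => ?_)
    exact ((hφ i).contDiffAt ((hVo i).mem_nhds (hχ i hx))).contMDiffAt
  · refine finsum_eq_zero_of_forall_eq_zero fun i => ?_
    by_cases hi : χ i y = 0
    · simp [hi]
    · simp [hφ0 i y ⟨hy, hmem i y hi⟩]
  · exact (convex_Iio (𝕜 := ℝ) (Φ y)).finsum_mem (fun i => χ.nonneg i y)
      (χ.sum_eq_one (subset_closure hy)) fun i hi => hφΦ i y ⟨hy, hmem i y hi⟩
  · rw [(hderiv y hy).fderiv]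
    exact (hC y).finsum_mem (fun i => χ.nonneg i y)
      (χ.sum_eq_one (frontier_subset_closure hy)) fun i hi => hφC i y ⟨hy, hmem i y hi⟩

/-- A global smooth defining function. -/
theorem HasDefiningFunctions.exists_global (h : HasDefiningFunctions U) (hU : IsOpen U)
    (hUc : IsCompact (closure U)) :
    ∃ ρ : E → ℝ, ContDiff ℝ ∞ ρ ∧ (∀ y ∈ frontier U, ρ y = 0) ∧ (∀ y ∈ U, ρ y < 0) ∧
      ∀ y ∈ frontier U, fderiv ℝ ρ y ≠ 0 := by
  suffices hsuff : ∃ ρ : E → ℝ, ContDiff ℝ ∞ ρ ∧ (∀ y ∈ frontier U, ρ y = 0) ∧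
      (∀ y ∈ U, ρ y < 0) ∧
      ∀ y ∈ frontier U, fderiv ℝ ρ y ∈ {l : E →L[ℝ] ℝ | ∀ v ∈ inwardCone U y, l v < 0} by
    obtain ⟨ρ, h1, h2, h3, h4⟩ := hsuff
    refine ⟨ρ, h1, h2, h3, fun y hy h0 => ?_⟩
    obtain ⟨V, r, hr, hyV, hr0⟩ := h y hy
    obtain ⟨v, hv⟩ := hr.inwardCone_nonempty hU hyV hy hr0
    have := h4 y hy v hv
    simp [h0] at this
  refine exists_contDiff_lt_of_local hU hUc (Φ := fun _ => 0) (m := -1)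
    (fun _ _ => by norm_num) (C := fun y => {l | ∀ v ∈ inwardCone U y, l v < 0}) ?_ ?_
  · intro y l₁ h₁ l₂ h₂ a b ha hb hab v hv
    exact (convex_Iio (𝕜 := ℝ) (0 : ℝ)) (h₁ v hv) (h₂ v hv) ha hb hab
  · intro z hz
    obtain ⟨V, r, hr, hzV, hr0⟩ := h z hz
    have hne : ∀ᶠ y in 𝓝 z, fderiv ℝ r y ≠ 0 := (hr.continuousAt_fderiv hzV).eventually_ne hr0
    obtain ⟨W, hWsub, hWo, hzW⟩ := mem_nhds_iff.1 (hne.and (hr.isOpen.mem_nhds hzV))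
    exact ⟨W, r, hWo, hzW, hr.contDiffOn.mono fun y hy => (hWsub hy).2,
      fun y hy => hr.eq_zero hU (hWsub hy.2).2 hy.1,
      fun y hy => (hr.mem_iff (hWsub hy.2).2).1 hy.1,
      fun y hy v hv => hr.fderiv_neg_of_mem_inwardCone hU (hWsub hy.2).2 hy.1 (hWsub hy.2).1 hv⟩

/-- A `C¹` function that vanishes on the boundary lies above a smooth function that vanishes on
the boundary and has almost the same differential there. Near a boundary point `z`, where
`DΦ = c Dr`, the function `(c + s) r` with small `s > 0` has these properties. -/
theorem HasDefiningFunctions.exists_contDiff_lt (h : HasDefiningFunctions U) (hU : IsOpen U)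
    (hUc : IsCompact (closure U)) {Φ : E → ℝ} (hΦ : ContDiffOn ℝ 1 Φ (closure U))
    (hΦ0 : ∀ y ∈ frontier U, Φ y = 0) {η : ℝ} (hη : 0 < η) :
    ∃ w : E → ℝ, ContDiff ℝ ∞ w ∧ (∀ y ∈ frontier U, w y = 0) ∧ (∀ y ∈ U, w y < Φ y) ∧
      ∀ y ∈ frontier U, ‖fderiv ℝ w y - fderivWithin ℝ Φ (closure U) y‖ < η := by
  have hu := h.uniqueDiffOn hU
  obtain ⟨B, hB⟩ := hUc.exists_bound_of_continuousOn hΦ.continuousOn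
  have hm : ∀ y ∈ U, -B - 1 < Φ y := fun y hy => by
    have := (abs_le.1 (hB y (subset_closure hy))).1
    linarith
  suffices hsuff : ∃ w : E → ℝ, ContDiff ℝ ∞ w ∧ (∀ y ∈ frontier U, w y = 0) ∧
      (∀ y ∈ U, w y < Φ y) ∧
      ∀ y ∈ frontier U, fderiv ℝ w y ∈ Metric.ball (fderivWithin ℝ Φ (closure U) y) η by
    simpa only [Metric.mem_ball, dist_eq_norm] using hsuff
  refine exists_contDiff_lt_of_local hU hUc hm (fun y => convex_ball _ _) ?_
  intro z hz
  have hzc : z ∈ closure U := frontier_subset_closure hz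
  obtain ⟨V, r, hr, hzV, hr0⟩ := h z hz
  obtain ⟨c, hc⟩ := hr.exists_fderivWithin_eq_smul hU hzV hz hr0 hu hΦ hΦ0
  set s : ℝ := η / (‖fderiv ℝ r z‖ + 1) with hs
  have hs0 : 0 < s := by positivity
  have hsη : s * ‖fderiv ℝ r z‖ < η := by
    rw [hs, div_mul_eq_mul_div, div_lt_iff₀ (by positivity)]
    nlinarith [norm_nonneg (fderiv ℝ r z)]
  have hg : ContinuousWithinAt (fderivWithin ℝ Φ (closure U)) (closure U) z :=
    hΦ.continuousOn_fderivWithin hu le_rfl z hzc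
  have hcont : ContinuousWithinAt
      (fun y => fderivWithin ℝ Φ (closure U) y - (c + s) • fderiv ℝ r y) (closure U) z :=
    hg.sub ((hr.continuousAt_fderiv hzV).continuousWithinAt.const_smul (c + s))
  have hval : fderivWithin ℝ Φ (closure U) z - (c + s) • fderiv ℝ r z = -(s • fderiv ℝ r z) := by
    rw [hc, add_smul]
    abel
  obtain ⟨a, ha⟩ := exists_fderiv_pos_of_ne_zero hr0
  have hpos := hr.eventually_pos hU hzV hz (hr.isOpen.mem_nhds hzV)
    (f := fun y => Φ y - (c + s) • r y)
    (fun y hy => ((hΦ.differentiableOn (by norm_num) y hy.1).hasFDerivWithinAt).fun_sub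
      ((hr.differentiableAt hy.2).hasFDerivAt.hasFDerivWithinAt.const_smul (c + s)))
    hcont (fun y hy => by simp [hΦ0 y hy.1, hr.eq_zero hU hy.2 hy.1]) ha
    (by rw [hval]; simpa using mul_pos hs0 ha)
  have hclose : ∀ᶠ y in 𝓝 z, y ∈ closure U →
      ‖fderivWithin ℝ Φ (closure U) y - (c + s) • fderiv ℝ r y‖ < η := by
    refine eventually_nhdsWithin_iff.1 (hcont.norm.eventually_lt_const ?_)
    beta_reduce
    rw [hval, norm_neg, norm_smul, Real.norm_of_nonneg hs0.le]
    exact hsη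
  obtain ⟨W, hWsub, hWo, hzW⟩ :=
    mem_nhds_iff.1 ((hpos.and hclose).and (hr.isOpen.mem_nhds hzV))
  refine ⟨W, fun y => (c + s) • r y, hWo, hzW,
    (hr.contDiffOn.mono fun y hy => (hWsub hy).2).const_smul (c + s),
    fun y hy => by simp [hr.eq_zero hU (hWsub hy.2).2 hy.1], fun y hy => ?_, fun y hy => ?_⟩
  · have := (hWsub hy.2).1.1 hy.1
    linarith
  · rw [fderiv_fun_const_smul (hr.differentiableAt (hWsub hy.2).2), Metric.mem_ball,
      dist_eq_norm, norm_sub_rev]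
    exact (hWsub hy.2).1.2 (frontier_subset_closure hy.1)

end Gluing

/-! ### Uniform bounds on compact sets -/

section Compactness

theorem exists_pos_forall_le {X : Type*} [TopologicalSpace X] {K : Set X} (hK : IsCompact K)
    {g : X → ℝ} (hg : ContinuousOn g K) (hpos : ∀ x ∈ K, 0 < g x) :
    ∃ c : ℝ, 0 < c ∧ ∀ x ∈ K, c ≤ g x := by
  rcases K.eq_empty_or_nonempty with rfl | hne
  · exact ⟨1, one_pos, by simp⟩
  · obtain ⟨x, hx, hmin⟩ := hK.exists_isMinOn hne hg
    exact ⟨g x, hpos x hx, fun y hy => hmin hy⟩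

theorem exists_pos_forall_le_of_nonneg {X : Type*} [TopologicalSpace X] [T2Space X] {K : Set X}
    (hK : IsCompact K) {f g : X → ℝ} (hf : ContinuousOn f K) (hg : ContinuousOn g K)
    (hpos : ∀ x ∈ K, 0 ≤ f x → 0 < g x) :
    ∃ c : ℝ, 0 < c ∧ ∀ x ∈ K, 0 ≤ f x → c ≤ g x := by
  have hK' : IsCompact (K ∩ f ⁻¹' Ici 0) :=
    hK.of_isClosed_subset (hf.preimage_isClosed_of_isClosed hK.isClosed isClosed_Ici)
      inter_subset_left
  obtain ⟨c, hc, h⟩ := exists_pos_forall_le hK' (hg.mono inter_subset_left)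
    fun x hx => hpos x hx.1 hx.2
  exact ⟨c, hc, fun x hx hfx => h x ⟨hx, hfx⟩⟩

theorem exists_nonneg_forall_abs_le {X : Type*} [TopologicalSpace X] {K : Set X}
    (hK : IsCompact K) {g : X → ℝ} (hg : ContinuousOn g K) :
    ∃ B : ℝ, 0 ≤ B ∧ ∀ x ∈ K, |g x| ≤ B := by
  obtain ⟨B, hB⟩ := hK.exists_bound_of_continuousOn hg
  exact ⟨max B 0, le_max_right _ _, fun x hx => (hB x hx).trans (le_max_left _ _)⟩

end Compactness

/-! ### Gradients and Laplacians up to the boundary -/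

section Differential

variable {E : Type*} [NormedAddCommGroup E] [InnerProductSpace ℝ E] [FiniteDimensional ℝ E]
  {s : Set E} {f : E → ℝ} {x : E}

theorem norm_gradientWithin : ‖gradientWithin f s x‖ = ‖fderivWithin ℝ f s x‖ := by
  simp [gradientWithin]

theorem norm_gradient : ‖gradient f x‖ = ‖fderiv ℝ f x‖ := by
  simp [gradient]

theorem gradientWithin_of_mem_nhds (hs : s ∈ 𝓝 x) : gradientWithin f s x = gradient f x := by
  simp [gradientWithin, gradient, fderivWithin_of_mem_nhds hs]

theorem continuousOn_gradientWithin (hs : UniqueDiffOn ℝ s) (hf : ContDiffOn ℝ 1 f s) :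
    ContinuousOn (gradientWithin f s) s :=
  (ofDual E).continuous.comp_continuousOn (hf.continuousOn_fderivWithin hs le_rfl)

theorem continuous_gradient (hf : ContDiff ℝ 1 f) : Continuous (gradient f) :=
  (ofDual E).continuous.comp (hf.continuous_fderiv (by norm_num))

theorem gradient_const_smul (c : ℝ) (hf : DifferentiableAt ℝ f x) :
    gradient (c • f) x = c • gradient f x := by
  change ofDual E (fderiv ℝ (c • f) x) = c • ofDual E (fderiv ℝ f x)
  rw [fderiv_const_smul hf, map_smul]

theorem continuousOn_laplacianWithin (hs : UniqueDiffOn ℝ s) (hf : ContDiffOn ℝ 2 f s) :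
    ContinuousOn (laplacianWithin f s) s := by
  have h1 : ContinuousOn (iteratedFDerivWithin ℝ 2 f s) s :=
    hf.continuousOn_iteratedFDerivWithin (m := 2) (by norm_num) hs
  refine ContinuousOn.congr (f := fun x => ∑ i, iteratedFDerivWithin ℝ 2 f s x
    ![(stdOrthonormalBasis ℝ E) i, (stdOrthonormalBasis ℝ E) i]) ?_ fun x hx =>
      laplacianWithin_eq_iteratedFDerivWithin_stdOrthonormalBasis f hs hx
  exact continuousOn_finsetSum _ fun i _ =>
    (continuous_eval_const (F := ContinuousMultilinearMap ℝ (fun _ : Fin 2 => E) ℝ)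
      ![(stdOrthonormalBasis ℝ E) i, (stdOrthonormalBasis ℝ E) i]).comp_continuousOn h1

theorem laplacianWithin_of_mem_nhds (hs : UniqueDiffOn ℝ s) (hx : s ∈ 𝓝 x) :
    laplacianWithin f s x = Laplacian.laplacian f x := by
  rw [laplacianWithin_eq_iteratedFDerivWithin_stdOrthonormalBasis f hs (mem_of_mem_nhds hx),
    laplacian_eq_iteratedFDeriv_stdOrthonormalBasis]
  have h : s =ᶠ[𝓝 x] univ := eventuallyEq_univ.2 hx
  rw [iteratedFDerivWithin_congr_set h, iteratedFDerivWithin_univ]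

theorem exists_laplacian_bound {U : Set E} (hU : IsOpen U) (hUc : IsCompact (closure U))
    (hs : UniqueDiffOn ℝ (closure U)) (hf : ContDiffOn ℝ 2 f (closure U)) :
    ∃ B : ℝ, 0 ≤ B ∧ ∀ x ∈ U, |Laplacian.laplacian f x| ≤ B := by
  obtain ⟨B, hB0, hB⟩ := exists_nonneg_forall_abs_le hUc (continuousOn_laplacianWithin hs hf)
  refine ⟨B, hB0, fun x hx => ?_⟩
  rw [← laplacianWithin_of_mem_nhds hs (mem_of_superset (hU.mem_nhds hx) subset_closure)]
  exact hB x (subset_closure hx)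

theorem exists_laplacian_bound_of_subset {U K : Set E} (hU : IsOpen U) (hK : IsCompact K)
    (hKU : K ⊆ U) (hf : ContDiffOn ℝ 2 f U) :
    ∃ B : ℝ, 0 ≤ B ∧ ∀ x ∈ K, |Laplacian.laplacian f x| ≤ B := by
  obtain ⟨B, hB0, hB⟩ := exists_nonneg_forall_abs_le hK
    ((continuousOn_laplacianWithin hU.uniqueDiffOn hf).mono hKU)
  refine ⟨B, hB0, fun x hx => ?_⟩
  rw [← laplacianWithin_of_mem_nhds hU.uniqueDiffOn (hU.mem_nhds (hKU hx))]
  exact hB x hx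

end Differential

/-! ### The penalty function -/

section Penalty

variable {γ : ℝ → ℝ} {ε : ℝ}

theorem IsPenalty.nonneg (hγ : IsPenalty γ) (s : ℝ) : 0 ≤ γ s := by
  rcases le_or_gt s 0 with h | h
  · exact (hγ.eq_zero s h).ge
  · exact (hγ.pos s h).le

theorem IsPenalty.deriv_nonneg (hγ : IsPenalty γ) (s : ℝ) : 0 ≤ deriv γ s := by
  rcases le_or_gt s 0 with h | h
  · have hmin : IsLocalMin γ s := Eventually.of_forall fun t => by
      rw [hγ.eq_zero s h]
      exact hγ.nonneg t
    exact hmin.deriv_eq_zero.ge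
  · exact (hγ.deriv_pos s h).le

theorem IsPenalty.differentiable (hγ : IsPenalty γ) : Differentiable ℝ γ :=
  hγ.smooth.differentiable (by simp)

theorem IsPenalty.monotone (hγ : IsPenalty γ) : Monotone γ :=
  monotone_of_deriv_nonneg hγ.differentiable hγ.deriv_nonneg

theorem IsPenalty.penalty_nonneg (hγ : IsPenalty γ) (s : ℝ) : 0 ≤ penalty γ ε s := hγ.nonneg _

theorem IsPenalty.penalty_eq_zero (hγ : IsPenalty γ) (hε : 0 < ε) {s : ℝ} (hs : s ≤ 0) :
    penalty γ ε s = 0 :=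
  hγ.eq_zero _ (div_nonpos_of_nonpos_of_nonneg hs hε.le)

theorem IsPenalty.penalty_mono (hγ : IsPenalty γ) (hε : 0 < ε) {s t : ℝ} (hst : s ≤ t) :
    penalty γ ε s ≤ penalty γ ε t :=
  hγ.monotone ((div_le_div_iff_of_pos_right hε).2 hst)

end Penalty

/-! ### Bounds on solutions and barriers -/

section Solutions

variable {n : ℕ} {U : Set (EuclideanSpace ℝ (Fin n))}
  {H : EuclideanSpace ℝ (Fin n) → EuclideanSpace ℝ (Fin n) → ℝ}
  {ψ u φ : EuclideanSpace ℝ (Fin n) → ℝ} {γ : ℝ → ℝ} {ε : ℝ} {x : EuclideanSpace ℝ (Fin n)}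

theorem HasSmoothBoundary.hasDefiningFunctions (h : HasSmoothBoundary U) :
    HasDefiningFunctions U := by
  intro z hz
  obtain ⟨V, r, hV, hzV, hr, hr0, hUV⟩ := h z hz
  exact ⟨V, r, ⟨hV, hr, hUV⟩, hzV, hr0⟩

theorem mem_or_mem_frontier (hU : IsOpen U) (hx : x ∈ closure U) : x ∈ U ∨ x ∈ frontier U := by
  rw [hU.frontier_eq]
  exact (em (x ∈ U)).imp_right fun h => ⟨hx, h⟩

theorem closure_mem_nhds (hU : IsOpen U) (hx : x ∈ U) : closure U ∈ 𝓝 x :=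
  mem_of_superset (hU.mem_nhds hx) subset_closure

theorem IsPenalizedSolution.contDiffAt (hu : IsPenalizedSolution U H ψ γ ε u) (hU : IsOpen U)
    (hx : x ∈ U) : ContDiffAt ℝ ∞ u x :=
  hu.smooth.contDiffAt (hU.mem_nhds hx)

/-- A solution is a viscosity subsolution; the test function `φ` need not agree with `u` at `x`. -/
theorem IsPenalizedSolution.le_of_isLocalMax (hu : IsPenalizedSolution U H ψ γ ε u)
    (hU : IsOpen U) (hε : 0 < ε) (hx : x ∈ U) (hφ : ContDiffAt ℝ 2 φ x)
    (hmax : IsLocalMax (fun y => u y - φ y) x) :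
    u x + H x (gradient φ x) + penalty γ ε (u x - ψ x) ≤ ε * Laplacian.laplacian φ x := by
  obtain ⟨h1, h2⟩ := gradient_eq_and_laplacian_le_of_isLocalMax
    ((hu.contDiffAt hU hx).of_le ENat.LEInfty.out) hφ hmax
  rw [← h1, hu.equation x hx]
  exact mul_le_mul_of_nonneg_left h2 hε.le

theorem IsPenalizedSolution.ge_of_isLocalMin (hu : IsPenalizedSolution U H ψ γ ε u)
    (hU : IsOpen U) (hε : 0 < ε) (hx : x ∈ U) (hφ : ContDiffAt ℝ 2 φ x)
    (hmin : IsLocalMin (fun y => u y - φ y) x) :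
    ε * Laplacian.laplacian φ x ≤ u x + H x (gradient φ x) + penalty γ ε (u x - ψ x) := by
  obtain ⟨h1, h2⟩ := gradient_eq_and_laplacian_ge_of_isLocalMin
    ((hu.contDiffAt hU hx).of_le ENat.LEInfty.out) hφ hmin
  rw [← h1, hu.equation x hx]
  exact mul_le_mul_of_nonneg_left h2 hε.le

theorem continuousOn_hamiltonian
    (hH : ContDiffOn ℝ ∞ (fun q : EuclideanSpace ℝ (Fin n) × EuclideanSpace ℝ (Fin n) => H q.1 q.2)
      (closure U ×ˢ univ))
    {G : EuclideanSpace ℝ (Fin n) → EuclideanSpace ℝ (Fin n)} (hG : ContinuousOn G (closure U)) :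
    ContinuousOn (fun x => H x (G x)) (closure U) :=
  hH.continuousOn.comp (f := fun x => (x, G x)) (continuousOn_id.prodMk hG) fun _ hx => ⟨hx, trivial⟩

/-- The bound on `u`, for every `ε`: at an interior maximum `u ≤ -H(x, 0)`, and at an interior
minimum either `u > ψ` or the penalty vanishes and `u ≥ -H(x, 0)`. -/
theorem exists_abs_le (hU : IsOpen U) (hUc : IsCompact (closure U)) (hUne : (closure U).Nonempty)
    (hH : ContDiffOn ℝ ∞ (fun q : EuclideanSpace ℝ (Fin n) × EuclideanSpace ℝ (Fin n) => H q.1 q.2)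
      (closure U ×ˢ univ))
    (hψ : ContinuousOn ψ (closure U)) (hγ : IsPenalty γ) :
    ∃ B : ℝ, 0 ≤ B ∧ ∀ ε : ℝ, 0 < ε → ∀ u, IsPenalizedSolution U H ψ γ ε u →
      ∀ x ∈ closure U, |u x| ≤ B := by
  obtain ⟨B₁, hB₁, h₁⟩ := exists_nonneg_forall_abs_le hUc
    (continuousOn_hamiltonian hH (continuousOn_const (c := 0)))
  obtain ⟨B₂, hB₂, h₂⟩ := exists_nonneg_forall_abs_le hUc hψ
  refine ⟨B₁ + B₂, by positivity, fun ε hε u hu => ?_⟩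
  have hcont := hu.contDiffOn_one.continuousOn
  have hconst : ∀ x, gradient (fun _ : EuclideanSpace ℝ (Fin n) => (0 : ℝ)) x = 0 := fun x =>
    gradient_fun_const x 0
  have hlap : ∀ x, Laplacian.laplacian (fun _ : EuclideanSpace ℝ (Fin n) => (0 : ℝ)) x = 0 :=
    fun x => by rw [laplacian_const]; rfl
  obtain ⟨a, ha, hmax⟩ := hUc.exists_isMaxOn hUne hcont
  obtain ⟨b, hb, hmin⟩ := hUc.exists_isMinOn hUne hcont
  have hupper : u a ≤ B₁ + B₂ := by
    rcases mem_or_mem_frontier hU ha with haU | haf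
    · have h := hu.le_of_isLocalMax hU hε haU (contDiffAt_const (c := (0 : ℝ)))
        (by simpa using hmax.isLocalMax (closure_mem_nhds hU haU))
      rw [hconst, hlap] at h
      have h3 := (abs_le.1 (h₁ a ha)).1
      have h4 := hγ.penalty_nonneg (ε := ε) (u a - ψ a)
      linarith
    · rw [hu.boundary a haf]; positivity
  have hlower : -(B₁ + B₂) ≤ u b := by
    rcases mem_or_mem_frontier hU hb with hbU | hbf
    · have h := hu.ge_of_isLocalMin hU hε hbU (contDiffAt_const (c := (0 : ℝ)))
        (by simpa using hmin.isLocalMin (closure_mem_nhds hU hbU))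
      rw [hconst, hlap] at h
      have h3 := (abs_le.1 (h₁ b hb)).2
      have h4 := (abs_le.1 (h₂ b hb)).1
      rcases le_or_gt (u b) (ψ b) with hle | hlt
      · rw [hγ.penalty_eq_zero hε (sub_nonpos.2 hle)] at h
        linarith
      · linarith
    · rw [hu.boundary b hbf]; linarith
  exact fun x hx => abs_le.2 ⟨hlower.trans (hmin hx), (hmax hx).trans hupper⟩

/-- The penalty term is bounded: evaluate the equation at a maximum of `u - ψ`. -/
theorem exists_penalty_le (hU : IsOpen U) (hUc : IsCompact (closure U))
    (hs : UniqueDiffOn ℝ (closure U)) (hUne : (closure U).Nonempty)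
    (hH : ContDiffOn ℝ ∞ (fun q : EuclideanSpace ℝ (Fin n) × EuclideanSpace ℝ (Fin n) => H q.1 q.2)
      (closure U ×ˢ univ))
    (hψ : ContDiffOn ℝ ∞ ψ (closure U)) (hψb : ∀ x ∈ frontier U, 0 ≤ ψ x) (hγ : IsPenalty γ)
    {B : ℝ} (hB : 0 ≤ B) :
    ∃ P : ℝ, 0 ≤ P ∧ ∀ ε : ℝ, 0 < ε → ε ≤ 1 → ∀ u, IsPenalizedSolution U H ψ γ ε u →
      (∀ x ∈ closure U, |u x| ≤ B) → ∀ x ∈ closure U, penalty γ ε (u x - ψ x) ≤ P := by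
  obtain ⟨B₁, hB₁, h₁⟩ := exists_nonneg_forall_abs_le hUc (continuousOn_hamiltonian hH
    (continuousOn_gradientWithin hs (hψ.of_le ENat.LEInfty.out)))
  obtain ⟨B₂, hB₂, h₂⟩ := exists_laplacian_bound hU hUc hs (hψ.of_le ENat.LEInfty.out)
  refine ⟨B + B₁ + B₂, by positivity, fun ε hε hε1 u hu huB => ?_⟩
  obtain ⟨a, ha, hmax⟩ := hUc.exists_isMaxOn hUne
    (hu.contDiffOn_one.continuousOn.sub hψ.continuousOn)
  refine fun x hx => (hγ.penalty_mono hε (hmax hx)).trans ?_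
  rcases mem_or_mem_frontier hU ha with haU | haf
  · have hnhds := closure_mem_nhds hU haU
    have h := hu.le_of_isLocalMax hU hε haU ((hψ.contDiffAt hnhds).of_le ENat.LEInfty.out)
      (hmax.isLocalMax hnhds)
    have h3 := (abs_le.1 (h₁ a ha)).1
    rw [gradientWithin_of_mem_nhds hnhds] at h3
    have h4 := (abs_le.1 (huB a ha)).1
    have h5 := (abs_le.1 (h₂ a haU)).2
    have h6 : ε * Laplacian.laplacian ψ a ≤ B₂ := by nlinarith
    have h7 : (u - ψ) a = u a - ψ a := rfl
    rw [h7]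
    linarith
  · have h7 : (u - ψ) a = u a - ψ a := rfl
    rw [h7, hγ.penalty_eq_zero hε (by rw [hu.boundary a haf]; linarith [hψb a haf])]
    positivity

/-- A large multiple of a defining function is an upper barrier: near the boundary its gradient is
so large that, by superlinear growth, `H` dominates the viscous term, and away from the boundary
it exceeds the bound on `u`. -/
theorem exists_upper_barrier (hU : IsOpen U) (hUc : IsCompact (closure U))
    (hUne : (closure U).Nonempty) (hs : UniqueDiffOn ℝ (closure U)) (hHc : IsCoercive U H)
    (hγ : IsPenalty γ) {ρ : EuclideanSpace ℝ (Fin n) → ℝ} (hρ : ContDiff ℝ ∞ ρ)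
    (hρ0 : ∀ y ∈ frontier U, ρ y = 0) (hρU : ∀ y ∈ U, ρ y < 0)
    (hρd : ∀ y ∈ frontier U, fderiv ℝ ρ y ≠ 0) {B : ℝ} (hB : 0 ≤ B) :
    ∃ K : ℝ, 0 ≤ K ∧ ∀ ε : ℝ, 0 < ε → ε ≤ 1 → ∀ u, IsPenalizedSolution U H ψ γ ε u →
      (∀ x ∈ closure U, |u x| ≤ B) → ∀ x ∈ closure U, u x ≤ -K * ρ x := by
  have hgrad : Continuous (gradient ρ) := continuous_gradient (hρ.of_le ENat.LEInfty.out)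
  have hUf : IsCompact (frontier U) := hUc.of_isClosed_subset isClosed_frontier
    frontier_subset_closure
  obtain ⟨c, hc, hcf⟩ := exists_pos_forall_le hUf hgrad.norm.continuousOn
    fun y hy => by rw [norm_gradient]; exact norm_pos_iff.2 (hρd y hy)
  -- Where `|Dρ|` is small, `ρ` is bounded away from zero.
  obtain ⟨δ, hδ, hδZ⟩ := exists_pos_forall_le_of_nonneg hUc
    (f := fun y => c / 2 - ‖gradient ρ y‖) (g := fun y => -ρ y)
    (continuous_const.sub hgrad.norm).continuousOn hρ.continuous.neg.continuousOn
    (fun y hy h => by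
      rcases mem_or_mem_frontier hU hy with hyU | hyf
      · linarith [hρU y hyU]
      · linarith [hcf y hyf])
  obtain ⟨L, hL, hLap⟩ := exists_laplacian_bound hU hUc hs
    ((hρ.of_le ENat.LEInfty.out).contDiffOn (n := 2))
  obtain ⟨R, hR⟩ := hHc.superlinear (2 * (L + 1) / c)
  -- The first two summands make `K δ ≥ B` and `K |Dρ| ≥ R` where `|Dρ| > c / 2`.
  set K : ℝ := B / δ + 2 * |R| / c + 1 with hK
  have hK1 : 0 < K := by positivity
  have hKδ : B ≤ K * δ := by
    have : B / δ * δ = B := by field_simp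
    have h2 : 0 ≤ (2 * |R| / c + 1) * δ := by positivity
    nlinarith
  have hKc : R ≤ K * (c / 2) := by
    have h1 : 2 * |R| / c * (c / 2) = |R| := by field_simp
    have h2 : 0 ≤ (B / δ + 1) * (c / 2) := by positivity
    nlinarith [le_abs_self R]
  refine ⟨K, hK1.le, fun ε hε hε1 u hu huB => ?_⟩
  have hcont : ContinuousOn (fun y => u y - ((-K) • ρ) y) (closure U) :=
    hu.contDiffOn_one.continuousOn.sub (hρ.continuous.const_smul (-K)).continuousOn
  obtain ⟨a, ha, hmax⟩ := hUc.exists_isMaxOn hUne hcont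
  suffices hsuff : u a - ((-K) • ρ) a ≤ 0 by
    intro x hx
    have h1 : u x - ((-K) • ρ) x ≤ u a - ((-K) • ρ) a := hmax hx
    simp only [Pi.smul_apply, smul_eq_mul] at h1 hsuff
    linarith
  by_contra! hpos
  simp only [Pi.smul_apply, smul_eq_mul] at hpos
  rcases mem_or_mem_frontier hU ha with haU | haf
  swap
  · rw [hu.boundary a haf, hρ0 a haf] at hpos
    linarith
  have hρa : ContDiffAt ℝ 2 ρ a := (hρ.of_le ENat.LEInfty.out).contDiffAt
  have hua := (abs_le.1 (huB a ha)).2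
  by_cases hZ : 0 ≤ c / 2 - ‖gradient ρ a‖
  · have := hδZ a ha hZ
    nlinarith
  have hg : c / 2 < ‖gradient ρ a‖ := by linarith
  have h := hu.le_of_isLocalMax (φ := (-K) • ρ) hU hε haU (hρa.const_smul (-K))
    (hmax.isLocalMax (closure_mem_nhds hU haU))
  rw [gradient_const_smul (-K) (hρa.differentiableAt (by norm_num)), laplacian_smul (-K) hρa] at h
  have hnorm : ‖(-K) • gradient ρ a‖ = K * ‖gradient ρ a‖ := by
    rw [norm_smul, Real.norm_eq_abs, abs_neg, abs_of_pos hK1]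
  have hp : 0 < K * ‖gradient ρ a‖ := mul_pos hK1 (by linarith)
  have hlarge : R ≤ ‖(-K) • gradient ρ a‖ := by
    rw [hnorm]
    nlinarith
  have hsup := hR a ha _ hlarge
  rw [hnorm, le_div_iff₀ hp] at hsup
  have h1 : K * (L + 1) ≤ 2 * (L + 1) / c * (K * ‖gradient ρ a‖) := by
    have h2 : 2 * (L + 1) / c * (K * (c / 2)) = K * (L + 1) := by field_simp
    rw [← h2]
    gcongr
  have h3 := (abs_le.1 (hLap a haU)).1
  have h4 : ε * ((-K) • Laplacian.laplacian ρ a) ≤ K * L := by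
    rw [smul_eq_mul]
    have h5 : -Laplacian.laplacian ρ a ≤ L := by linarith
    have h6 : ε * (K * -Laplacian.laplacian ρ a) ≤ ε * (K * L) := by gcongr
    have h7 : ε * (K * L) ≤ 1 * (K * L) := by gcongr
    linarith
  have h8 := hγ.penalty_nonneg (ε := ε) (u a - ψ a)
  have h9 : K * ρ a < 0 := by nlinarith [hρU a haU]
  nlinarith

/-- The strict inequality `Φ + H(x, p) < 0` on the boundary persists for all `p` uniformly close
to `DΦ`. -/
theorem IsStrictSubsolution.exists_perturbation {Φ : EuclideanSpace ℝ (Fin n) → ℝ}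
    (hΦ : IsStrictSubsolution U H ψ Φ) (hUc : IsCompact (closure U))
    (hs : UniqueDiffOn ℝ (closure U))
    (hH : ContDiffOn ℝ ∞ (fun q : EuclideanSpace ℝ (Fin n) × EuclideanSpace ℝ (Fin n) => H q.1 q.2)
      (closure U ×ˢ univ)) :
    ∃ η : ℝ, 0 < η ∧ ∀ y ∈ closure U, ∀ p, ‖p - gradientWithin Φ (closure U) y‖ < η →
      Φ y + H y p < 0 := by
  have hg := continuousOn_gradientWithin hs hΦ.contDiffOn_one
  have hK : IsCompact (closure U ×ˢ Metric.closedBall (0 : EuclideanSpace ℝ (Fin n)) 1) :=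
    hUc.prod (isCompact_closedBall _ _)
  have hmap : ContinuousOn (fun q : EuclideanSpace ℝ (Fin n) × EuclideanSpace ℝ (Fin n) =>
      (q.1, gradientWithin Φ (closure U) q.1 + q.2)) (closure U ×ˢ Metric.closedBall 0 1) :=
    continuousOn_fst.prodMk
      ((hg.comp continuousOn_fst fun q hq => hq.1).add continuousOn_snd)
  have hF : ContinuousOn (fun q : EuclideanSpace ℝ (Fin n) × EuclideanSpace ℝ (Fin n) =>
      Φ q.1 + H q.1 (gradientWithin Φ (closure U) q.1 + q.2))
      (closure U ×ˢ Metric.closedBall 0 1) :=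
    (hΦ.contDiffOn_one.continuousOn.comp continuousOn_fst fun q hq => hq.1).add
      (hH.continuousOn.comp hmap fun q hq => ⟨hq.1, trivial⟩)
  obtain ⟨η, hη, h⟩ := exists_pos_forall_le_of_nonneg hK hF
    (g := fun q => ‖q.2‖) continuous_snd.norm.continuousOn (fun q hq h0 => by
      rw [norm_pos_iff]
      intro hq2
      rw [hq2, add_zero] at h0
      exact absurd (hΦ.neg q.1 hq.1) (not_lt.2 h0))
  refine ⟨min η 1, by positivity, fun y hy p hp => ?_⟩
  by_contra! hc
  have := h (y, p - gradientWithin Φ (closure U) y)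
    ⟨hy, by simpa using (hp.trans_le (min_le_right _ _)).le⟩ (by simpa using hc)
  exact absurd (hp.trans_le (min_le_left _ _)) (not_lt.2 this)

/-- The lower barrier. Let `w` be the smooth function below `Φ` with `w = 0` and `Dw ≈ DΦ` on the
boundary. Then `max w (Φ - c / 2)` is a strict subsolution for small `c`: it equals `Φ - c / 2`
only on a compact subset of `U`, where `ΔΦ` is bounded, and elsewhere `w` is still a strict
subsolution with bounded Laplacian. -/
theorem IsStrictSubsolution.exists_lower_barrier {Φ : EuclideanSpace ℝ (Fin n) → ℝ}
    (hΦ : IsStrictSubsolution U H ψ Φ) (hU : IsOpen U) (hUc : IsCompact (closure U))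
    (hUne : (closure U).Nonempty) (hd : HasDefiningFunctions U)
    (hH : ContDiffOn ℝ ∞ (fun q : EuclideanSpace ℝ (Fin n) × EuclideanSpace ℝ (Fin n) => H q.1 q.2)
      (closure U ×ˢ univ)) (hγ : IsPenalty γ) :
    ∃ w : EuclideanSpace ℝ (Fin n) → ℝ, ContDiff ℝ ∞ w ∧ (∀ y ∈ frontier U, w y = 0) ∧
      ∃ ε₁ : ℝ, 0 < ε₁ ∧ ∀ ε : ℝ, 0 < ε → ε < ε₁ → ∀ u, IsPenalizedSolution U H ψ γ ε u →
        ∀ x ∈ closure U, w x ≤ u x := by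
  have hs := hd.uniqueDiffOn hU
  have hUf : IsCompact (frontier U) := hUc.of_isClosed_subset isClosed_frontier
    frontier_subset_closure
  obtain ⟨η, hη, hpert⟩ := hΦ.exists_perturbation hUc hs hH
  obtain ⟨w, hw, hw0, hwΦ, hwd⟩ := hd.exists_contDiff_lt hU hUc hΦ.contDiffOn_one hΦ.boundary hη
  refine ⟨w, hw, hw0, ?_⟩
  have hΦc := hΦ.contDiffOn_one.continuousOn
  have hwg : Continuous (gradient w) := continuous_gradient (hw.of_le ENat.LEInfty.out)
  have hF : ContinuousOn (fun y => w y + H y (gradient w y)) (closure U) :=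
    hw.continuous.continuousOn.add (continuousOn_hamiltonian hH hwg.continuousOn)
  obtain ⟨κ₁, hκ₁, hFf⟩ := exists_pos_forall_le hUf
    (g := fun y => -(w y + H y (gradient w y))) (hF.mono frontier_subset_closure).neg
    (fun y hy => by
      have h1 := hpert y (frontier_subset_closure hy) (gradient w y) (by
        have : gradient w y - gradientWithin Φ (closure U) y =
            ofDual _ (fderiv ℝ w y - fderivWithin ℝ Φ (closure U) y) := by
          rw [map_sub]
          rfl
        rw [this, ofDual_apply, LinearIsometryEquiv.norm_map]
        exact hwd y hy)
      rw [hΦ.boundary y hy] at h1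
      rw [hw0 y hy]
      linarith)
  -- Where `w` fails to be a strict subsolution, it lies below `Φ - c`.
  obtain ⟨c, hc, hZ⟩ := exists_pos_forall_le_of_nonneg hUc
    (f := fun y => w y + H y (gradient w y) + κ₁ / 2) (g := fun y => Φ y - w y)
    (hF.add continuousOn_const) (hΦc.sub hw.continuous.continuousOn)
    (fun y hy h => by
      rcases mem_or_mem_frontier hU hy with hyU | hyf
      · linarith [hwΦ y hyU]
      · linarith [hFf y hyf])
  obtain ⟨κ₂, hκ₂, hΦκ⟩ := exists_pos_forall_le hUc
    (g := fun y => -(Φ y + H y (gradientWithin Φ (closure U) y)))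
    (hΦc.add (continuousOn_hamiltonian hH (continuousOn_gradientWithin hs hΦ.contDiffOn_one))).neg
    (fun y hy => by linarith [hΦ.neg y hy])
  -- The set where the barrier may equal `Φ - c / 2`.
  have hKc : IsCompact (closure U ∩ (fun y => Φ y - w y) ⁻¹' Ici (c / 2)) :=
    hUc.of_isClosed_subset ((hΦc.sub hw.continuous.continuousOn).preimage_isClosed_of_isClosed
      isClosed_closure isClosed_Ici) inter_subset_left
  have hKU : closure U ∩ (fun y => Φ y - w y) ⁻¹' Ici (c / 2) ⊆ U := by
    rintro y ⟨hy, hyc⟩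
    refine (mem_or_mem_frontier hU hy).resolve_right fun hyf => ?_
    have : c / 2 ≤ Φ y - w y := hyc
    rw [hΦ.boundary y hyf, hw0 y hyf] at this
    linarith
  obtain ⟨L₁, hL₁, hLw⟩ := exists_laplacian_bound hU hUc hs
    ((hw.of_le ENat.LEInfty.out).contDiffOn (n := 2))
  obtain ⟨L₂, hL₂, hLΦ⟩ := exists_laplacian_bound_of_subset hU hKc hKU hΦ.contDiffOn_two
  refine ⟨min (κ₁ / 2) κ₂ / (L₁ + L₂ + 1), by positivity, fun ε hε hε1 u hu => ?_⟩
  rw [lt_div_iff₀ (by positivity)] at hε1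
  have hε₁ : ε * L₁ < κ₁ / 2 := by
    have := hε1.trans_le (min_le_left _ _)
    nlinarith
  have hε₂ : ε * L₂ < κ₂ := by
    have := hε1.trans_le (min_le_right _ _)
    nlinarith
  have hWc : ContinuousOn (fun y => u y - max (w y) (Φ y - c / 2)) (closure U) :=
    hu.contDiffOn_one.continuousOn.sub
      (hw.continuous.continuousOn.sup (hΦc.sub continuousOn_const))
  obtain ⟨a, ha, hmin⟩ := hUc.exists_isMinOn hUne hWc
  suffices hsuff : 0 ≤ u a - max (w a) (Φ a - c / 2) by
    intro x hx
    have h1 : u a - max (w a) (Φ a - c / 2) ≤ u x - max (w x) (Φ x - c / 2) := hmin hx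
    linarith [le_max_left (w x) (Φ x - c / 2)]
  by_contra! hneg
  rcases mem_or_mem_frontier hU ha with haU | haf
  swap
  · rw [hu.boundary a haf, hw0 a haf, hΦ.boundary a haf, max_eq_left (by linarith)] at hneg
    linarith
  have hnhds := closure_mem_nhds hU haU
  have hle : ∀ y ∈ closure U,
      u a - max (w a) (Φ a - c / 2) ≤ u y - max (w y) (Φ y - c / 2) := fun y hy => hmin hy
  have hψa := hΦ.le_obstacle a ha
  have hwa := hwΦ a haU
  rcases le_total (Φ a - c / 2) (w a) with hcase | hcase
  · rw [max_eq_left hcase] at hneg hle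
    have hlmin : IsLocalMin (fun y => u y - w y) a := by
      filter_upwards [hnhds] with y hy
      linarith [hle y hy, le_max_left (w y) (Φ y - c / 2)]
    have h := hu.ge_of_isLocalMin hU hε haU (hw.of_le ENat.LEInfty.out).contDiffAt hlmin
    rw [hγ.penalty_eq_zero hε (by linarith)] at h
    have h1 : w a + H a (gradient w a) + κ₁ / 2 < 0 := by
      by_contra! h2
      linarith [hZ a ha h2]
    have h3 := (abs_le.1 (hLw a haU)).1
    nlinarith
  · rw [max_eq_right hcase] at hneg hle
    have hlmin : IsLocalMin (fun y => u y - Φ y) a := by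
      filter_upwards [hnhds] with y hy
      linarith [hle y hy, le_max_right (w y) (Φ y - c / 2)]
    have h := hu.ge_of_isLocalMin hU hε haU (hΦ.contDiffOn_two.contDiffAt (hU.mem_nhds haU)) hlmin
    rw [hγ.penalty_eq_zero hε (by linarith)] at h
    have h1 := hΦκ a ha
    rw [gradientWithin_of_mem_nhds hnhds] at h1
    have h3 := (abs_le.1 (hLΦ a ⟨ha, by simp only [mem_preimage, mem_Ici]; linarith⟩)).1
    nlinarith

end Solutions

/-! ### The gradient bound -/

section Gradient

variable {n : ℕ} {U : Set (EuclideanSpace ℝ (Fin n))}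
  {H : EuclideanSpace ℝ (Fin n) → EuclideanSpace ℝ (Fin n) → ℝ}
  {ψ u : EuclideanSpace ℝ (Fin n) → ℝ} {γ : ℝ → ℝ} {ε : ℝ} {x : EuclideanSpace ℝ (Fin n)}

/-- On the boundary, a function squeezed between two smooth functions that agree with it there
has its gradient bounded by theirs. -/
theorem exists_boundary_gradient_bound (hU : IsOpen U) (hUc : IsCompact (closure U))
    (hd : HasDefiningFunctions U) {w v : EuclideanSpace ℝ (Fin n) → ℝ} (hw : ContDiff ℝ ∞ w)
    (hv : ContDiff ℝ ∞ v) (hw0 : ∀ y ∈ frontier U, w y = 0) (hv0 : ∀ y ∈ frontier U, v y = 0) :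
    ∃ L : ℝ, 0 ≤ L ∧ ∀ u : EuclideanSpace ℝ (Fin n) → ℝ, ContDiffOn ℝ 1 u (closure U) →
      (∀ y ∈ frontier U, u y = 0) → (∀ y ∈ closure U, w y ≤ u y) →
      (∀ y ∈ closure U, u y ≤ v y) →
      ∀ y ∈ frontier U, ‖gradientWithin u (closure U) y‖ ≤ L := by
  obtain ⟨L₁, hL₁, h₁⟩ := exists_nonneg_forall_abs_le hUc
    (hw.continuous_fderiv (by simp)).norm.continuousOn
  obtain ⟨L₂, hL₂, h₂⟩ := exists_nonneg_forall_abs_le hUc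
    (hv.continuous_fderiv (by simp)).norm.continuousOn
  refine ⟨L₁ + L₂, by positivity, fun u hu hu0 hwu huv y hy => ?_⟩
  have hyc : y ∈ closure U := frontier_subset_closure hy
  obtain ⟨V, r, hr, hyV, hr0⟩ := hd y hy
  rw [norm_gradientWithin]
  refine hr.norm_le_of_inwardCone hU hyV hy hr0 (by positivity) fun e he => ?_
  have hud := (hu.differentiableOn (by norm_num) y hyc).hasFDerivWithinAt
  have hwd := ((hw.differentiable (by simp)) y).hasFDerivAt.hasFDerivWithinAt (s := closure U)
  have hvd := ((hv.differentiable (by simp)) y).hasFDerivAt.hasFDerivWithinAt (s := closure U)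
  have hlow := fderiv_le_of_le_of_mem_inwardCone hwd hud hwu (by rw [hw0 y hy, hu0 y hy]) he
  have hupp := fderiv_le_of_le_of_mem_inwardCone hud hvd huv (by rw [hv0 y hy, hu0 y hy]) he
  have a1 := (abs_le.1 ((fderiv ℝ w y).le_opNorm e)).1
  have a2 := (abs_le.1 ((fderiv ℝ v y).le_opNorm e)).2
  have b1 := mul_le_mul_of_nonneg_right ((le_abs_self _).trans (h₁ y hyc)) (norm_nonneg e)
  have b2 := mul_le_mul_of_nonneg_right ((le_abs_self _).trans (h₂ y hyc)) (norm_nonneg e)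
  have c1 := mul_nonneg hL₁ (norm_nonneg e)
  have c2 := mul_nonneg hL₂ (norm_nonneg e)
  rw [abs_le, add_mul]
  constructor <;> linarith

/-- Cauchy–Schwarz for the trace of the Hessian: `(Δu)² ≤ n |D²u|²`. -/
theorem laplacian_sq_le {b : OrthonormalBasis (Fin n) ℝ (EuclideanSpace ℝ (Fin n))}
    (hA : ∀ a c, inner ℝ (fderiv ℝ (gradient u) x a) c = fderiv ℝ (fderiv ℝ u) x a c) :
    Laplacian.laplacian u x ^ 2 ≤ n * ∑ i, ‖fderiv ℝ (gradient u) x (b i)‖ ^ 2 := by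
  rw [laplacian_eq_sum_fderiv b u x]
  have h := sq_sum_le_card_mul_sum_sq (s := (Finset.univ : Finset (Fin n)))
    (f := fun i => fderiv ℝ (fderiv ℝ u) x (b i) (b i))
  rw [Finset.card_univ, Fintype.card_fin] at h
  refine h.trans (mul_le_mul_of_nonneg_left (Finset.sum_le_sum fun i _ => ?_) n.cast_nonneg)
  have hi := abs_real_inner_le_norm (fderiv ℝ (gradient u) x (b i)) (b i)
  rw [b.norm_eq_one, mul_one, hA] at hi
  rw [← sq_abs (fderiv ℝ (fderiv ℝ u) x (b i) (b i))]
  exact pow_le_pow_left₀ (abs_nonneg _) hi 2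

/-- The derivative of the equation at `x` in a direction `v` annihilated by `D²u`. -/
theorem IsPenalizedSolution.fderiv_equation (hu : IsPenalizedSolution U H ψ γ ε u) (hU : IsOpen U)
    (hH : ContDiffOn ℝ ∞ (fun q : EuclideanSpace ℝ (Fin n) × EuclideanSpace ℝ (Fin n) => H q.1 q.2)
      (closure U ×ˢ univ))
    (hψ : ContDiffOn ℝ ∞ ψ (closure U)) (hγ : IsPenalty γ) (hx : x ∈ U)
    (hg : DifferentiableAt ℝ (gradient u) x)
    (hlap : DifferentiableAt ℝ (Laplacian.laplacian u) x)
    {v : EuclideanSpace ℝ (Fin n)} (hv : fderiv ℝ (gradient u) x v = 0) :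
    fderiv ℝ u x v + fderivWithin ℝ (fun y => H y (gradient u x)) (closure U) x v +
      deriv γ ((u x - ψ x) / ε) * (ε⁻¹ * (fderiv ℝ u x v - fderiv ℝ ψ x v)) =
      ε * fderiv ℝ (Laplacian.laplacian u) x v := by
  have hnhds := closure_mem_nhds hU hx
  have hud : HasFDerivAt u (fderiv ℝ u x) x :=
    ((hu.contDiffAt hU hx).differentiableAt (by simp)).hasFDerivAt
  have hgd := hg.hasFDerivAt
  set p := gradient u x with hp
  set A := fderiv ℝ (gradient u) x with hAdef
  have hHd : HasFDerivAt (fun q : EuclideanSpace ℝ (Fin n) × EuclideanSpace ℝ (Fin n) => H q.1 q.2)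
      (fderiv ℝ (fun q : EuclideanSpace ℝ (Fin n) × EuclideanSpace ℝ (Fin n) => H q.1 q.2) (x, p))
      (x, p) :=
    ((hH.contDiffAt (prod_mem_nhds hnhds univ_mem)).differentiableAt (by simp)).hasFDerivAt
  set DH := fderiv ℝ (fun q : EuclideanSpace ℝ (Fin n) × EuclideanSpace ℝ (Fin n) => H q.1 q.2)
    (x, p) with hDH
  have hHg : HasFDerivAt (fun y => H y (gradient u y))
      (DH ∘L ((ContinuousLinearMap.id ℝ _).prod A)) x :=
    HasFDerivAt.comp (f := fun y => (y, gradient u y)) x hHd ((hasFDerivAt_id x).prodMk hgd)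
  have hHx : fderivWithin ℝ (fun y => H y p) (closure U) x v = DH (v, 0) := by
    have h1 : HasFDerivAt (fun y => H y p) (DH ∘L ((ContinuousLinearMap.id ℝ _).prod 0)) x :=
      HasFDerivAt.comp (f := fun y => (y, p)) x hHd ((hasFDerivAt_id x).prodMk
        (hasFDerivAt_const p x))
    rw [fderivWithin_of_mem_nhds hnhds, h1.fderiv]
    rfl
  have hψd : HasFDerivAt ψ (fderiv ℝ ψ x) x :=
    ((hψ.contDiffAt hnhds).differentiableAt (by simp)).hasFDerivAt
  have hpen : HasFDerivAt (fun y => penalty γ ε (u y - ψ y))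
      (deriv γ ((u x - ψ x) / ε) • (ε⁻¹ • (fderiv ℝ u x - fderiv ℝ ψ x))) x := by
    have h1 : HasFDerivAt (fun y => (u y - ψ y) / ε) (ε⁻¹ • (fderiv ℝ u x - fderiv ℝ ψ x)) x := by
      have h2 := (hud.fun_sub hψd).const_smul ε⁻¹
      refine h2.congr_of_eventuallyEq (Eventually.of_forall fun y => ?_)
      simp [div_eq_inv_mul]
    exact (hγ.differentiable _).hasDerivAt.comp_hasFDerivAt x h1
  have heq : (fun y => u y + H y (gradient u y) + penalty γ ε (u y - ψ y)) =ᶠ[𝓝 x]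
      fun y => ε * Laplacian.laplacian u y := by
    filter_upwards [hU.mem_nhds hx] with y hy using hu.equation y hy
  have hderiv := ((hud.fun_add hHg).fun_add hpen).unique
    ((hlap.hasFDerivAt.const_mul ε).congr_of_eventuallyEq heq)
  have hdir := congrArg (fun l => l v) hderiv
  simp only [add_apply, smul_apply, sub_apply, smul_eq_mul, ContinuousLinearMap.comp_apply,
    ContinuousLinearMap.prod_apply, ContinuousLinearMap.id_apply, hv] at hdir
  rw [hHx]
  exact hdir

/-- The algebra behind Bernstein's estimate: `a + h = ε l` is the equation, `d` stands for
`D_xH · p`, `t` for `|p|²` plus the derivative of the penalty, `Q` for `|D²u|²`, and `m` for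
`D(Δu) · p`. -/
theorem bernstein_algebra {a h l d t Q m N ε : ℝ} (hε : 0 < ε) (hεN : ε * N ≤ 1) (hQ : 0 ≤ Q)
    (heq : a + h = ε * l) (hl : l ^ 2 ≤ N * Q) (hm : Q + m ≤ 0) (ht : 0 ≤ t)
    (hd : d + t = ε * m) : 1 / 2 * h ^ 2 + d ≤ a ^ 2 := by
  have h1 : ε ^ 2 * l ^ 2 ≤ ε ^ 2 * (N * Q) := mul_le_mul_of_nonneg_left hl (sq_nonneg ε)
  have h2 : ε * Q * (ε * N) ≤ ε * Q * 1 := mul_le_mul_of_nonneg_left hεN (mul_nonneg hε.le hQ)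
  have h3 : ε * (Q + m) ≤ 0 := mul_nonpos_of_nonneg_of_nonpos hε.le hm
  have h4 : (a + h) ^ 2 = ε ^ 2 * l ^ 2 := by rw [heq]; ring
  -- `(a + h)² ≥ h² / 2 - a²`, with difference `(h + 2 a)² / 2`.
  have h5 := sq_nonneg (h + 2 * a)
  linarith

/-- Bernstein's estimate. At an interior maximum of `|Du|²` where `|Du| ≥ |Dψ|`, the derivative of
the equation in the direction `p = Du` gives
`|p|² + D_xH · p + γ'(|p|² - Dψ · p) / ε + ε |D²u|² ≤ 0`, and
`ε |D²u|² ≥ (ε Δu)² = (u + H + γ^ε)²` because `n ε ≤ 1`. -/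
theorem IsPenalizedSolution.bernstein (hu : IsPenalizedSolution U H ψ γ ε u) (hU : IsOpen U)
    (hH : ContDiffOn ℝ ∞ (fun q : EuclideanSpace ℝ (Fin n) × EuclideanSpace ℝ (Fin n) => H q.1 q.2)
      (closure U ×ˢ univ))
    (hψ : ContDiffOn ℝ ∞ ψ (closure U)) (hγ : IsPenalty γ) (hε : 0 < ε) (hεn : ε * n ≤ 1)
    (hx : x ∈ U) (hmax : IsLocalMax (fun y => ‖gradient u y‖ ^ 2) x)
    (hle : ‖gradient ψ x‖ ≤ ‖gradient u x‖) :
    1 / 2 * |H x (gradient u x)| ^ 2 +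
      fderivWithin ℝ (fun y => H y (gradient u x)) (closure U) x (gradient u x) ≤
      (u x + penalty γ ε (u x - ψ x)) ^ 2 := by
  have hnhds := closure_mem_nhds hU hx
  have hu3 : ContDiffAt ℝ 3 u x := (hu.contDiffAt hU hx).of_le ENat.LEInfty.out
  have hDu : ContDiffAt ℝ 2 (fderiv ℝ u) x := hu3.fderiv_right (by norm_num)
  have hg : ContDiffAt ℝ 2 (gradient u) x := (ofDual _).contDiff.contDiffAt.comp x hDu
  set p := gradient u x with hp
  set A := fderiv ℝ (gradient u) x with hAdef
  set b := EuclideanSpace.basisFun (Fin n) ℝ with hb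
  have hgd : HasFDerivAt (gradient u) A x := (hg.differentiableAt (by norm_num)).hasFDerivAt
  have hA : ∀ a c, inner ℝ (A a) c = fderiv ℝ (fderiv ℝ u) x a c := by
    intro a c
    have h1 : A = ofDual _ ∘L fderiv ℝ (fderiv ℝ u) x :=
      ((ofDual _).hasFDerivAt.comp x (hDu.differentiableAt (by norm_num)).hasFDerivAt).fderiv
    rw [h1]
    exact inner_ofDual _ c
  have hsymm : ∀ a c, fderiv ℝ (fderiv ℝ u) x a c = fderiv ℝ (fderiv ℝ u) x c a := fun a c =>
    ((hu3.of_le (by norm_num : (2 : WithTop ℕ∞) ≤ 3)).isSymmSndFDerivAt (by simp)) a c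
  -- The first-order condition `D²u p = 0`.
  have hAp : A p = 0 := by
    refine ext_inner_right ℝ fun v => ?_
    rw [hA, hsymm, ← hA, inner_zero_left, real_inner_comm]
    have h1 := hmax.hasFDerivAt_eq_zero hgd.norm_sq
    have h2 := congrArg (fun l => l v) h1
    simpa [-inner_gradient_left] using h2
  have hsecond : ∑ i, ‖A (b i)‖ ^ 2 +
      ∑ i, inner ℝ p (fderiv ℝ (fderiv ℝ (gradient u)) x (b i) (b i)) ≤ 0 := by
    rw [← Finset.sum_add_distrib]
    exact Finset.sum_nonpos fun i _ => norm_sq_fderiv_add_inner_nonpos_of_isLocalMax hg hmax (b i)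
  obtain ⟨hlapd, hlap⟩ := fderiv_laplacian_apply b hu3 p
  have hdir := hu.fderiv_equation hU hH hψ hγ hx (hg.differentiableAt (by norm_num)) hlapd hAp
  rw [hlap, ← hp] at hdir
  have hupp : fderiv ℝ u x p = ‖p‖ ^ 2 := by
    rw [← inner_gradient_left (𝕜 := ℝ), ← hp, real_inner_self_eq_norm_sq]
  have hψp : fderiv ℝ ψ x p ≤ ‖p‖ ^ 2 := by
    rw [← inner_gradient_left (𝕜 := ℝ), sq]
    exact (real_inner_le_norm _ _).trans (mul_le_mul_of_nonneg_right hle (norm_nonneg p))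
  have hpen0 : 0 ≤ deriv γ ((u x - ψ x) / ε) * (ε⁻¹ * (fderiv ℝ u x p - fderiv ℝ ψ x p)) := by
    have h1 : 0 ≤ fderiv ℝ u x p - fderiv ℝ ψ x p := by rw [hupp]; linarith
    have h2 := hγ.deriv_nonneg ((u x - ψ x) / ε)
    positivity
  have hS := hu.equation x hx
  rw [← hp] at hS
  have hCS := laplacian_sq_le (b := b) hA
  rw [hupp] at hdir hpen0
  rw [sq_abs]
  refine bernstein_algebra (Q := ∑ i, ‖A (b i)‖ ^ 2) (l := Laplacian.laplacian u x) hε hεn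
    (Finset.sum_nonneg fun i _ => sq_nonneg _) ?_ hCS hsecond
    (add_nonneg (sq_nonneg ‖p‖) hpen0) ?_
  · rw [← hS]
    ring
  · rw [← hdir]
    ring

/-- A bound for the gradient on the boundary gives a bound on the whole closure. -/
theorem exists_gradient_bound (hU : IsOpen U) (hUc : IsCompact (closure U))
    (hUne : (closure U).Nonempty) (hs : UniqueDiffOn ℝ (closure U))
    (hH : ContDiffOn ℝ ∞ (fun q : EuclideanSpace ℝ (Fin n) × EuclideanSpace ℝ (Fin n) => H q.1 q.2)
      (closure U ×ˢ univ))
    (hHc : IsCoercive U H) (hψ : ContDiffOn ℝ ∞ ψ (closure U)) (hγ : IsPenalty γ) {B P L : ℝ}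
    (hP : 0 ≤ P) (hL : 0 ≤ L) :
    ∃ C : ℝ, 0 ≤ C ∧ ∀ ε : ℝ, 0 < ε → ε * n ≤ 1 → ∀ u, IsPenalizedSolution U H ψ γ ε u →
      (∀ x ∈ closure U, |u x| ≤ B) → (∀ x ∈ closure U, penalty γ ε (u x - ψ x) ≤ P) →
      (∀ x ∈ frontier U, ‖gradientWithin u (closure U) x‖ ≤ L) →
      ∀ x ∈ closure U, ‖gradientWithin u (closure U) x‖ ≤ C := by
  obtain ⟨G, hG0, hG⟩ := exists_nonneg_forall_abs_le hUc
    (continuousOn_gradientWithin hs (hψ.of_le ENat.LEInfty.out)).norm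
  obtain ⟨R, hR⟩ := hHc.bernstein ((B + P) ^ 2 + 1)
  refine ⟨L + G + |R|, by positivity, fun ε hε hεn u hu huB huP huL => ?_⟩
  obtain ⟨a, ha, hmax⟩ := hUc.exists_isMaxOn hUne
    (continuousOn_gradientWithin hs hu.contDiffOn_one).norm
  suffices hsuff : ‖gradientWithin u (closure U) a‖ ≤ L + G + |R| from
    fun x hx => le_trans (hmax hx) hsuff
  rcases mem_or_mem_frontier hU ha with haU | haf
  swap
  · linarith [huL a haf, abs_nonneg R]
  by_contra! hlt
  have hnhds := closure_mem_nhds hU haU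
  have hgu : ∀ y ∈ U, gradientWithin u (closure U) y = gradient u y := fun y hy =>
    gradientWithin_of_mem_nhds (closure_mem_nhds hU hy)
  rw [hgu a haU] at hlt
  have hlmax : IsLocalMax (fun y => ‖gradient u y‖ ^ 2) a := by
    filter_upwards [hU.mem_nhds haU] with y hy
    have h1 : ‖gradientWithin u (closure U) y‖ ≤ ‖gradientWithin u (closure U) a‖ :=
      hmax (subset_closure hy)
    rw [hgu y hy, hgu a haU] at h1
    gcongr
  have hψa := (le_abs_self _).trans (hG a ha)
  rw [gradientWithin_of_mem_nhds hnhds] at hψa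
  have h1 := hu.bernstein hU hH hψ hγ hε hεn haU hlmax (by linarith [abs_nonneg R])
  have h2 := hR a ha (gradient u a) (by linarith [le_abs_self R])
  have h3 : (u a + penalty γ ε (u a - ψ a)) ^ 2 ≤ (B + P) ^ 2 := by
    have h4 := hγ.penalty_nonneg (ε := ε) (u a - ψ a)
    have h5 := huP a ha
    have h6 := abs_le.1 (huB a ha)
    exact sq_le_sq' (by linarith) (by linarith)
  linarith

end Gradient

end ObstacleProblem

end

theorem mainTheorem9 (n : ℕ) (hn : 2 ≤ n)
    (U : Set (EuclideanSpace ℝ (Fin n)))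
    (hUo : IsOpen U) (hUc : IsConnected U) (hUb : Bornology.IsBounded U)
    (hUs : ObstacleProblem.HasSmoothBoundary U)
    (H : EuclideanSpace ℝ (Fin n) → EuclideanSpace ℝ (Fin n) → ℝ)
    (hH : ContDiffOn ℝ ∞
      (fun q : EuclideanSpace ℝ (Fin n) × EuclideanSpace ℝ (Fin n) => H q.1 q.2)
      (closure U ×ˢ Set.univ))
    (hHc : ObstacleProblem.IsCoercive U H)
    (ψ : EuclideanSpace ℝ (Fin n) → ℝ)
    (hψ : ContDiffOn ℝ ∞ ψ (closure U))
    (hψb : ∀ x ∈ frontier U, 0 ≤ ψ x)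
    (hΦ : ∃ Φ : EuclideanSpace ℝ (Fin n) → ℝ, ObstacleProblem.IsStrictSubsolution U H ψ Φ)
    (γ : ℝ → ℝ) (hγ : ObstacleProblem.IsPenalty γ) :
    ∃ ε₀ : ℝ, 0 < ε₀ ∧ ∃ C : ℝ, 0 < C ∧
      ∀ ε : ℝ, 0 < ε →
        ∀ u : EuclideanSpace ℝ (Fin n) → ℝ,
          ObstacleProblem.IsPenalizedSolution U H ψ γ ε u →
            (∀ x ∈ closure U, |u x| ≤ C) ∧
            (ε < ε₀ → ∀ x ∈ closure U, ‖gradientWithin u (closure U) x‖ ≤ C) := by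
  open ObstacleProblem in
  obtain ⟨Φ, hΦ⟩ := hΦ
  have hcpt : IsCompact (closure U) := hUb.isCompact_closure
  have hne : (closure U).Nonempty := hUc.nonempty.closure
  have hd := hUs.hasDefiningFunctions
  have hs := hd.uniqueDiffOn hUo
  obtain ⟨B, hB, huB⟩ := exists_abs_le hUo hcpt hne hH hψ.continuousOn hγ
  obtain ⟨P, hP, huP⟩ := exists_penalty_le hUo hcpt hs hne hH hψ hψb hγ hB
  obtain ⟨ρ, hρ, hρ0, hρU, hρd⟩ := hd.exists_global hUo hcpt
  obtain ⟨K, hK, hupper⟩ := exists_upper_barrier (ψ := ψ) hUo hcpt hne hs hHc hγ hρ hρ0 hρU hρd hB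
  obtain ⟨w, hw, hw0, ε₁, hε₁, hlower⟩ := hΦ.exists_lower_barrier hUo hcpt hne hd hH hγ
  obtain ⟨L, hL, hbdry⟩ := exists_boundary_gradient_bound hUo hcpt hd hw
    (v := fun y => -K * ρ y) (contDiff_const.mul hρ) hw0 (fun y hy => by simp [hρ0 y hy])
  obtain ⟨C, hC, hgrad⟩ := exists_gradient_bound hUo hcpt hne hs hH hHc hψ hγ (B := B) hP hL
  have hn0 : (1 : ℝ) ≤ n := by exact_mod_cast (by omega : 1 ≤ n)
  -- The bound `1 / n` absorbs the constant in `(Δu)² ≤ n |D²u|²`.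
  refine ⟨min ε₁ (1 / n), by positivity, B + C + 1, by positivity, fun ε hε u hu => ?_⟩
  have hb := huB ε hε u hu
  refine ⟨fun x hx => by linarith [hb x hx], fun hε0 x hx => ?_⟩
  have hεn : ε * n ≤ 1 := by
    have := hε0.le.trans (min_le_right _ _)
    rwa [le_div_iff₀ (by linarith)] at this
  have hε1 : ε ≤ 1 := by nlinarith
  have := hgrad ε hε hεn u hu hb (huP ε hε hε1 u hu hb)
    (hbdry u hu.contDiffOn_one hu.boundary
      (hlower ε hε (hε0.trans_le (min_le_left _ _)) u hu) (hupper ε hε hε1 u hu hb)) x hx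
  linarith
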